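/- **Setting.** There is one target market, $h=0$, and there are $H\ge 0$ source markets, $h=1,\dots,H$, each with a catalog of $N\ge1$ products. Market $h$ has a parameter $\nu^{(h)}=(\theta^{(h)},\gamma^{(h)})\in\mathbb R^{2d}$. In each period the covariate vectors $x^{(h)}_{it}\in\mathbb R^d$ are drawn i.i.d. over products, periods and markets from a law $\mathcal P_x$. If the assortment $S\subseteq[N]$, $|S|\le K$, is offered at prices $p\in[0,\bar P]^N$ in market $h$, then the customer buys $i\in S$ with probability $$q(i\mid S,p,\nu^{(h)})=\frac{e^{v_i}}{1+\sum_{\ell\in S}e^{v_\ell}},\qquad v_i=\langle x^{(h)}_{it},\theta^{(h)}\rangle-\langle x^{(h)}_{it},\gamma^{(h)}\rangle p_i ,$$ and buys nothing (option $0$) otherwise, independently over markets given covariates and decisions. In the target market let $R_t(S,p)=\sum_{i\in S}p_i\,q(i\mid S,p,\nu^{(0)})$. A policy $\pi$ chooses, possibly at random, the target decision $(S_t,p_t)$ of period $t$ from the covariates of period $t$ and the covariates, decisions and purchases of the earlier periods in all markets. The decisions in the source markets (again $|S|\le K$, prices in $[0,\bar P]$) are made by a given, possibly randomized rule that the seller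 does not control. The regret is $$\mathrm{Regret}(T;\pi)=\mathbb E\sum_{t=1}^T\Big(\max_{|S|\le K,\;p\in[0,\bar P]^N}R_t(S,p)-R_t(S_t,p_t)\Big).$$ **Assumptions on an instance** $(\mathcal P_x,(\nu^{(h)})_h,\text{source rule})$, with constants $s_0,L_0,C_{\min},C_{\max},\kappa,r$: 1. there is $J\subseteq[2d]$, $|J|\le s_0$, such that $\nu^{(0)}_j=\nu^{(h)}_j$ for all $j\notin J$ and all $h\in[H]$; 2. $\langle x,\gamma^{(h)}\rangle\ge L_0$ for $\mathcal P_x$-almost every $x$ and every $h$; 3. $\|x\|_\infty\le1$ for $\mathcal P_x$-almost every $x$, and $\|\nu^{(h)}\|_2\le1$ for every $h$; 4. almost surely, for all $|S|\le K$, $p\in[0,\bar P]^N$ and $\nu$ with $\|\nu-\nu^{(0)}\|_2\le r$, all probabilities $q(i\mid S,p,\nu)$, $i\in S\cup\{0\}$, in the target market are at least $\kappa$; 5. all eigenvalues of $\Sigma=\mathbb E_{x\sim\mathcal P_x}[xx^\top]$ lie in $[C_{\min},C_{\max}]$. **Theorem 3 (Minimax lower bound).** Let $0<L_0<1$, $L_0^2<C_{\max}$,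 $0<C_{\min}\le\min\{1,C_{\max}\}$ and $\bar P\in\mathbb R$. There are constants $c_0,\kappa,r>0$, depending only on $L_0,\bar P,C_{\min},C_{\max}$, such that for all $d\ge1$, $K\in[d]$, $s_0\in\{0,1,\dots,\min\{K,d\}\}$ with $\bar P\ge(1+\sqrt d+\log K)/L_0$ (so that the price cap $\bar P$ does not bind), all $N\ge1$, $H\ge0$ and all horizons $T$, $$\inf_\pi\ \sup_{\text{instances}}\ \mathrm{Regret}(T;\pi)\ \ge\ c_0\left[\sqrt{\frac{K(d-s_0)T}{1+H}}+s_0\sqrt{KT}\right],$$ where the infimum is over all policies and the supremum is over all instances that satisfy 1–5 and in which the source decisions do not react to the seller's decision of the same period. The same bound, with the same constants, holds if the supremum is taken instead over the instances that satisfy 1–5 and in which every source market repeats the seller's decision of the same period (so that each of the seller's decisions is answered by $1+H$ purchases). -/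

import Mathlib

open MeasureTheory ProbabilityTheory
open scoped ENNReal

namespace TransferPricing

/-! ### Actions, contexts, choices -/

/-- Assortments: subsets of the catalog `[N]` with at most `K` products. -/
def Assortment (N K : ℕ) : Type := {S : Finset (Fin N) // S.card ≤ K}

instance (N K : ℕ) : MeasurableSpace (Assortment N K) := ⊤

instance (N K : ℕ) : DiscreteMeasurableSpace (Assortment N K) := ⟨fun _ => trivial⟩

/-- A decision in one market in one period: an assortment and a vector of prices in `[0, P]`
(the prices of products that are not offered play no role). -/
abbrev Action (N K : ℕ) (P : ℝ) : Type := Assortment N K × (Fin N → Set.Icc (0 : ℝ) P)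

/-- The customer's choice: a product, or `none`, the outside option. -/
abbrev Choice (N : ℕ) : Type := Option (Fin N)

instance (N : ℕ) : MeasurableSpace (Choice N) := ⊤

instance (N : ℕ) : DiscreteMeasurableSpace (Choice N) := ⟨fun _ => trivial⟩

/-- The covariate vectors of the `N` products in one market. -/
abbrev Covariates (d N : ℕ) : Type := Fin N → Fin d → ℝ

/-- The covariates in all markets in one period; market `0` is the target market, and the
markets `1, …, H` are the source markets. -/
abbrev Contexts (d N H : ℕ) : Type := Fin (H + 1) → Covariates d N

/-- A preference parameter `ν = (θ, γ) ∈ ℝ^{2d}`: the coordinates `Sum.inl j` are those of `θ`,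
and the coordinates `Sum.inr j` are those of the price sensitivity `γ`. -/
abbrev Param (d : ℕ) : Type := Fin d ⊕ Fin d → ℝ

noncomputable section

/-! ### The multinomial logit model -/

/-- `⟨x, θ⟩`. -/
def baseUtility {d : ℕ} (ν : Param d) (x : Fin d → ℝ) : ℝ := ∑ j, x j * ν (Sum.inl j)

/-- `⟨x, γ⟩`. -/
def priceSensitivity {d : ℕ} (ν : Param d) (x : Fin d → ℝ) : ℝ := ∑ j, x j * ν (Sum.inr j)

/-- The systematic utility `v = ⟨x, θ⟩ - ⟨x, γ⟩ p`. -/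
def utility {d : ℕ} (ν : Param d) (x : Fin d → ℝ) (p : ℝ) : ℝ :=
  baseUtility ν x - priceSensitivity ν x * p

variable {d N K H : ℕ} {P : ℝ}

/-- `1 + ∑_{ℓ ∈ S} exp v_ℓ`. -/
def logitDenom (ν : Param d) (X : Covariates d N) (a : Action N K P) : ℝ :=
  1 + ∑ l ∈ a.1.1, Real.exp (utility ν (X l) (a.2 l))

/-- The multinomial logit choice probabilities. -/
def choiceProb (ν : Param d) (X : Covariates d N) (a : Action N K P) : Choice N → ℝ
  | none => 1 / logitDenom ν X a
  | some i => if i ∈ a.1.1 then Real.exp (utility ν (X i) (a.2 i)) / logitDenom ν X a else 0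

/-- The expected revenue `R(S, p) = ∑_{i ∈ S} p_i q(i ∣ S, p)`. -/
def revenue (ν : Param d) (X : Covariates d N) (a : Action N K P) : ℝ :=
  ∑ i ∈ a.1.1, (a.2 i : ℝ) * choiceProb ν X a (some i)

/-- The revenue of the clairvoyant, who knows `ν`: the maximum of `R(S, p)` over the assortments
with at most `K` products and the prices in `[0, P]`. -/
def optRevenue (K : ℕ) (P : ℝ) (ν : Param d) (X : Covariates d N) : ℝ :=
  ⨆ a : Action N K P, revenue ν X a

lemma measurable_utility (ν : Param d) (i : Fin N) :
    Measurable fun z : Covariates d N × Action N K P => utility ν (z.1 i) (z.2.2 i) := by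
  unfold utility baseUtility priceSensitivity
  fun_prop

lemma measurable_logitDenom (ν : Param d) :
    Measurable fun z : Covariates d N × Action N K P => logitDenom ν z.1 z.2 := by
  have h : (fun z : Covariates d N × Action N K P => logitDenom ν z.1 z.2) = fun z =>
      1 + ∑ l, if l ∈ z.2.1.1 then Real.exp (utility ν (z.1 l) (z.2.2 l)) else 0 := by
    funext z
    simp [logitDenom]
  rw [h]
  refine measurable_const.add (Finset.measurable_fun_sum _ fun l _ => ?_)
  refine Measurable.ite ?_ (Real.measurable_exp.comp (measurable_utility ν l)) measurable_const
  exact (measurable_fst.comp measurable_snd)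
    (MeasurableSet.of_discrete (s := {S : Assortment N K | l ∈ S.1}))

lemma measurable_choiceProb (ν : Param d) (y : Choice N) :
    Measurable fun z : Covariates d N × Action N K P => choiceProb ν z.1 z.2 y := by
  cases y with
  | none => exact measurable_const.div (measurable_logitDenom ν)
  | some i =>
    refine Measurable.ite ?_
      ((Real.measurable_exp.comp (measurable_utility ν i)).div (measurable_logitDenom ν))
      measurable_const
    exact (measurable_fst.comp measurable_snd)
      (MeasurableSet.of_discrete (s := {S : Assortment N K | i ∈ S.1}))

lemma measurable_choiceProb_comp {Z : Type*} [MeasurableSpace Z] (ν : Param d) (y : Choice N)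
    {f : Z → Covariates d N} {g : Z → Action N K P} (hf : Measurable f) (hg : Measurable g) :
    Measurable fun z => choiceProb ν (f z) (g z) y := by
  have h := (measurable_choiceProb (K := K) (P := P) ν y).comp (hf.prodMk hg)
  simpa only [Function.comp_def] using h

lemma logitDenom_pos (ν : Param d) (X : Covariates d N) (a : Action N K P) :
    0 < logitDenom ν X a := by
  unfold logitDenom
  positivity

lemma choiceProb_nonneg (ν : Param d) (X : Covariates d N) (a : Action N K P) (y : Choice N) :
    0 ≤ choiceProb ν X a y := by
  have := logitDenom_pos ν X a
  cases y with
  | none => unfold choiceProb; positivity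
  | some i =>
    change 0 ≤ if i ∈ a.1.1 then Real.exp (utility ν (X i) (a.2 i)) / logitDenom ν X a else 0
    split_ifs <;> positivity

lemma sum_choiceProb (ν : Param d) (X : Covariates d N) (a : Action N K P) :
    ∑ y, choiceProb ν X a y = 1 := by
  have h0 := (logitDenom_pos ν X a).ne'
  have h : ∑ y, choiceProb ν X a y
      = choiceProb ν X a none + ∑ i : Fin N, choiceProb ν X a (some i) :=
    Fintype.sum_option (choiceProb ν X a)
  rw [h]
  simp only [choiceProb, Finset.sum_ite_mem, Finset.univ_inter, ← Finset.sum_div]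
  rw [← add_div, div_eq_one_iff_eq h0]
  rfl

/-! ### Interaction -/

/-- What happens in one period: the covariates, the seller's decision in the target market, the
decisions in the source markets, and the customers' choices in all markets. -/
abbrev Round (d N K H : ℕ) (P : ℝ) : Type :=
  ((Contexts d N H × Action N K P) × (Fin H → Action N K P)) × (Fin (H + 1) → Choice N)

/-- Records of the first `n` periods. -/
def History (d N K H : ℕ) (P : ℝ) : ℕ → Type
  | 0 => Unit
  | n + 1 => History d N K H P n × Round d N K H P

instance History.measurableSpace (d N K H : ℕ) (P : ℝ) :
    ∀ n, MeasurableSpace (History d N K H P n)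
  | 0 => inferInstanceAs (MeasurableSpace Unit)
  | n + 1 =>
    letI := History.measurableSpace d N K H P n
    inferInstanceAs (MeasurableSpace (History d N K H P n × Round d N K H P))

/-- A (randomized, nonanticipating) policy of the seller: in each period, the decision in the
target market is drawn from a law that depends on the record of the previous periods in all
markets and on the current covariates. -/
structure Policy (d N K H : ℕ) (P : ℝ) where
  act : ∀ n, Kernel (History d N K H P n × Contexts d N H) (Action N K P)
  markov : ∀ n, IsMarkovKernel (act n)

/-- A rule by which the decisions in the source markets are made. -/
structure SourceRule (d N K H : ℕ) (P : ℝ) where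
  act : ∀ n, Kernel (History d N K H P n × (Contexts d N H × Action N K P))
    (Fin H → Action N K P)
  markov : ∀ n, IsMarkovKernel (act n)

attribute [instance] Policy.markov SourceRule.markov

/-- The source markets have policies of their own: the decisions there do not react to the
seller's current decision in the target market. -/
def SourceRule.Autonomous (σ : SourceRule d N K H P) : Prop :=
  ∀ n h X a a', σ.act n (h, (X, a)) = σ.act n (h, (X, a'))

/-- Every source market repeats the seller's current decision in the target market. -/
def SourceRule.Mirroring (σ : SourceRule d N K H P) : Prop :=
  ∀ n h X a, σ.act n (h, (X, a)) = Measure.dirac fun _ => a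

/-- The decisions in all markets: `a` in the target market and `b` in the source markets. -/
def decisions (a : Action N K P) (b : Fin H → Action N K P) : Fin (H + 1) → Action N K P :=
  Fin.cons a b

lemma measurable_decisions (h : Fin (H + 1)) :
    Measurable fun z : (Contexts d N H × Action N K P) × (Fin H → Action N K P) =>
      decisions z.1.2 z.2 h := by
  refine Fin.cases ?_ (fun i => ?_) h
  · simp only [decisions, Fin.cons_zero]
    exact measurable_snd.comp measurable_fst
  · simp only [decisions, Fin.cons_succ]
    exact (measurable_pi_apply i).comp measurable_snd

/-- Probability that the customers in the `H + 1` markets, independently of one another, make the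
choices `y`, given the covariates and the decisions. -/
def jointChoiceProb (ν : Fin (H + 1) → Param d)
    (z : (Contexts d N H × Action N K P) × (Fin H → Action N K P))
    (y : Fin (H + 1) → Choice N) : ℝ :=
  ∏ h, choiceProb (ν h) (z.1.1 h) (decisions z.1.2 z.2 h) (y h)

lemma measurable_jointChoiceProb (ν : Fin (H + 1) → Param d) (y : Fin (H + 1) → Choice N) :
    Measurable fun z : (Contexts d N H × Action N K P) × (Fin H → Action N K P) =>
      jointChoiceProb ν z y := by
  unfold jointChoiceProb
  refine Finset.measurable_fun_prod _ fun h _ => ?_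
  exact measurable_choiceProb_comp (ν h) (y h)
    ((measurable_pi_apply h).comp (measurable_fst.comp measurable_fst)) (measurable_decisions h)

lemma sum_jointChoiceProb (ν : Fin (H + 1) → Param d)
    (z : (Contexts d N H × Action N K P) × (Fin H → Action N K P)) :
    ∑ y, jointChoiceProb ν z y = 1 := by
  have h := Finset.prod_univ_sum (fun _ : Fin (H + 1) => (Finset.univ : Finset (Choice N)))
    (fun h c => choiceProb (ν h) (z.1.1 h) (decisions z.1.2 z.2 h) c)
  rw [Fintype.piFinset_univ] at h
  unfold jointChoiceProb
  rw [← h]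
  exact Finset.prod_eq_one fun h _ => sum_choiceProb _ _ _

/-- The law of the customers' choices in all markets. -/
def choiceKernel (ν : Fin (H + 1) → Param d) :
    Kernel ((Contexts d N H × Action N K P) × (Fin H → Action N K P))
      (Fin (H + 1) → Choice N) where
  toFun z := ∑ y, ENNReal.ofReal (jointChoiceProb ν z y) • Measure.dirac y
  measurable' := by
    refine Measure.measurable_of_measurable_coe _ fun s hs => ?_
    simp only [Measure.coe_finsetSum, Measure.coe_smul, Finset.sum_apply, Pi.smul_apply,
      smul_eq_mul]
    exact Finset.measurable_fun_sum _ fun y _ =>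
      (measurable_jointChoiceProb ν y).ennreal_ofReal.mul_const _

instance (ν : Fin (H + 1) → Param d) :
    IsMarkovKernel (choiceKernel (N := N) (K := K) (P := P) ν) := by
  refine ⟨fun z => ⟨?_⟩⟩
  have h : choiceKernel ν z Set.univ = ∑ y, ENNReal.ofReal (jointChoiceProb ν z y) := by
    change (∑ y, ENNReal.ofReal (jointChoiceProb ν z y) • Measure.dirac y) Set.univ = _
    simp
  rw [h, ← ENNReal.ofReal_sum_of_nonneg, sum_jointChoiceProb, ENNReal.ofReal_one]
  exact fun y _ => Finset.prod_nonneg fun h _ => choiceProb_nonneg _ _ _ _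

/-! ### Problem instances and regret -/

/-- A problem instance: the common law of the covariate vectors, the preference parameters of the
target market (index `0`) and of the source markets, and the rule of the source markets. -/
structure Market (d N K H : ℕ) (P : ℝ) where
  covLaw : ProbabilityMeasure (Fin d → ℝ)
  ν : Fin (H + 1) → Param d
  source : SourceRule d N K H P

/-- The law of the covariates in one period: independent copies over markets and products. -/
def Market.contextLaw (I : Market d N K H P) : Measure (Contexts d N H) :=
  Measure.pi fun _ => Measure.pi fun _ => (I.covLaw : Measure (Fin d → ℝ))

/-- The law of period `n + 1` given the first `n` periods. -/
def Market.step (I : Market d N K H P) (π : Policy d N K H P) (n : ℕ) :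
    Kernel (History d N K H P n) (Round d N K H P) :=
  ((Kernel.const _ I.contextLaw ⊗ₖ π.act n) ⊗ₖ I.source.act n) ⊗ₖ
    Kernel.prodMkLeft _ (choiceKernel I.ν)

/-- The law of the record of the first `n` periods. -/
def Market.law (I : Market d N K H P) (π : Policy d N K H P) :
    ∀ n, Measure (History d N K H P n)
  | 0 => (Measure.dirac () : Measure Unit)
  | n + 1 => (I.law π n) ⊗ₘ (I.step π n)

/-- The clairvoyant's expected revenue in the target market minus the seller's, in one period. -/
def Market.gap (I : Market d N K H P) (ρ : Round d N K H P) : ℝ :=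
  optRevenue K P (I.ν 0) (ρ.1.1.1 0) - revenue (I.ν 0) (ρ.1.1.1 0) ρ.1.1.2

/-- The cumulative expected regret of the policy `π` up to horizon `T`. -/
def Market.regret (I : Market d N K H P) (π : Policy d N K H P) (T : ℕ) : ℝ≥0∞ :=
  ∑ n ∈ Finset.range T,
    ∫⁻ h : History d N K H P n × Round d N K H P, ENNReal.ofReal (I.gap h.2) ∂(I.law π (n + 1))

/-- The matrix `Σ = E[x xᵀ]`. -/
def secondMoment (μ : ProbabilityMeasure (Fin d → ℝ)) : Matrix (Fin d) (Fin d) ℝ :=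
  Matrix.of fun i j => ∫ x, x i * x j ∂(μ : Measure (Fin d → ℝ))

/-- The assumptions on an instance, with sparsity level `s₀` and constants `L₀` (price
sensitivity), `Cmin`, `Cmax` (eigenvalues of `Σ`), `κ`, `r` (non-degeneracy). -/
structure Market.Admissible (I : Market d N K H P) (s₀ : ℕ) (L₀ Cmin Cmax κ r : ℝ) : Prop where
  /-- Structured preference shift. -/
  shift : ∃ J : Finset (Fin d ⊕ Fin d), J.card ≤ s₀ ∧
    ∀ h : Fin H, ∀ j, j ∉ J → I.ν 0 j - I.ν h.succ j = 0
  /-- Positive price sensitivity, in every market. -/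
  sensitivity : ∀ h, ∀ᵐ x ∂(I.covLaw : Measure (Fin d → ℝ)), L₀ ≤ priceSensitivity (I.ν h) x
  /-- Bounded covariates. -/
  covariates : ∀ᵐ x ∂(I.covLaw : Measure (Fin d → ℝ)), ∀ j, |x j| ≤ 1
  /-- Bounded parameters, in every market. -/
  params : ∀ h, ‖WithLp.toLp 2 (I.ν h)‖ ≤ 1
  /-- Non-degeneracy of the choice probabilities around the target parameter. -/
  nondegenerate : ∀ᵐ X ∂(Measure.pi fun _ : Fin N => (I.covLaw : Measure (Fin d → ℝ))),
    ∀ a : Action N K P, ∀ ν' : Param d, ‖WithLp.toLp 2 (ν' - I.ν 0)‖ ≤ r →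
      κ ≤ choiceProb ν' X a none ∧ ∀ i ∈ a.1.1, κ ≤ choiceProb ν' X a (some i)
  /-- All eigenvalues of `Σ` lie in `[Cmin, Cmax]`. -/
  eigenvalues : ∀ c ∈ spectrum ℝ (secondMoment I.covLaw), Cmin ≤ c ∧ c ≤ Cmax

/-- The minimax regret `inf_π sup_I Regret(T; π)` over a class of instances. -/
def minimaxRegret (d N K H : ℕ) (P : ℝ) (T : ℕ) (C : Set (Market d N K H P)) : ℝ≥0∞ :=
  ⨅ π : Policy d N K H P, ⨆ I ∈ C, I.regret π T

end

end TransferPricing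

/-! The hypothesis on the cap forces `1 ≤ P` and `K ≤ d ≤ P ^ 2`, and the constants may depend on
`P`. Factors of `K`, `d`, `s₀` are therefore absorbed into `c₀`, and only the rate `√(T / M)` has to
be proved, where `M` measures how much the source markets amplify the information: `M = 1` if they
reveal nothing, `M = 1 + H` if they share and mirror the target.

The rate comes from two hypotheses whose demand curves cross at an uninformative price. In the base
model all utilities are `-b p`, and the optimal price is `u / b` with `u = 1 + m exp(-u)`, `m = min
K N`. In the perturbed model they are `-b p - δ (p - u / b)`. The models agree at the price `u / b`,
so purchases separate them only if the seller prices elsewhere, which costs revenue in the base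
model. Let `V` be the expected cumulative sum, under the base model, of the squared distances of the
offered prices to `u / b`. The Kullback–Leibler divergence of the two records is at most `M δ² V`
(`sum_choiceProb_mul_neg_logLik_le`, `Market.integral_cumulative`), while the base regret is at
least `c₃ V` (`quadratic_revenue_loss`).

If `M δ² V > 1`, the base regret exceeds `c₃ / (M δ²)`. Otherwise the two laws overlap
(`two_point_bound`); no decision is good in both models, as prices near `u / b` lose order `δ²` in
the perturbed one (`improved_revenue`, `perturbed_revenue_le`, `loss_tradeoff`), so the two regrets
add up to order `δ² T`. This is `regret_dichotomy`; `δ²` of order `1 / √(T M)` balances the cases.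

It remains to choose sources. Autonomous sources stay idle, so `M = 1`. Mirroring sources with `s₀ =
0` must share the target parameter, so `M = 1 + H`. Mirroring sources with `s₀ ≥ 1` can have one
parameter under both hypotheses, one coordinate away from each target, so again `M = 1`. -/

namespace MeasureTheory.Measure

/-- Composition products of measures and kernels with densities multiply the densities. -/
theorem compProd_withDensity_mul {α β : Type*} [MeasurableSpace α] [MeasurableSpace β]
    (μ : Measure α) [SFinite μ] (κ η : Kernel α β) [IsMarkovKernel κ] [IsMarkovKernel η]
    {f : α → ℝ≥0∞} {g : β → ℝ≥0∞} (hf : Measurable f) (hg : Measurable g)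
    (h : ∀ a, η a = (κ a).withDensity g) :
    (μ.withDensity f) ⊗ₘ η = (μ ⊗ₘ κ).withDensity fun z => f z.1 * g z.2 := by
  refine Measure.ext_of_lintegral _ fun φ hφ => ?_
  have hinner : ∀ a, ∫⁻ b, φ (a, b) ∂(η a) = ∫⁻ b, g b * φ (a, b) ∂(κ a) := fun a => by
    rw [h a, lintegral_withDensity_eq_lintegral_mul _ hg (by fun_prop)]
    rfl
  rw [lintegral_compProd hφ, lintegral_withDensity_eq_lintegral_mul _ hf
      (Measurable.lintegral_kernel_prod_right' hφ),
    lintegral_withDensity_eq_lintegral_mul _ (by fun_prop) hφ, lintegral_compProd (by fun_prop)]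
  refine lintegral_congr fun a => ?_
  simp only [Pi.mul_apply]
  rw [hinner, ← lintegral_const_mul _ (by fun_prop)]
  simp only [mul_assoc]

end MeasureTheory.Measure

/-! ### Overlap of two laws with bounded divergence. -/

namespace TransferPricing

/-- An affine lower bound of `min 1 (exp x)` in `x` and `exp x`. -/
lemma affine_le_min_one_exp (x : ℝ) :
    Real.exp (-4) * (1 + (x - Real.exp x) / 4) ≤ min 1 (Real.exp x) := by
  have h1 : x + 1 ≤ Real.exp x := Real.add_one_le_exp x
  have h4 : 0 < Real.exp (-4) := Real.exp_pos _
  have h41 : Real.exp (-4) ≤ 1 := Real.exp_le_one_iff.2 (by norm_num)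
  refine le_min ?_ ?_
  · nlinarith
  -- Below `-4` the affine expression is negative; above, its prefactor `exp (-4)` is already at
  -- most `exp x`.
  · rcases le_or_gt (-4) x with hx | hx
    · have := Real.exp_le_exp.2 hx
      nlinarith
    · have := Real.exp_pos x
      nlinarith

/-- If the log-likelihood ratio `Λ` of `μ₁` with respect to `μ₀` has expectation at least `-1`
under `μ₀`, then no decision has a small loss under both measures. -/
theorem two_point_bound {α : Type*} [MeasurableSpace α] (μ₀ μ₁ : Measure α)
    [IsProbabilityMeasure μ₀] [IsProbabilityMeasure μ₁] {Λ : α → ℝ} (hΛ : Measurable Λ) {B : ℝ}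
    (hB : ∀ x, |Λ x| ≤ B) (hμ : μ₁ = μ₀.withDensity fun x => ENNReal.ofReal (Real.exp (Λ x)))
    (hkl : -1 ≤ ∫ x, Λ x ∂μ₀) {g₀ g₁ : α → ℝ} (hg₀ : Measurable g₀) (hg₁ : Measurable g₁)
    {Δ : ℝ} (hΔ : 0 ≤ Δ) (hg : ∀ x, ENNReal.ofReal Δ ≤ ENNReal.ofReal (g₀ x) +
      ENNReal.ofReal (g₁ x)) :
    ENNReal.ofReal (Δ * (Real.exp (-4) / 2)) ≤
      ∫⁻ x, ENNReal.ofReal (g₀ x) ∂μ₀ + ∫⁻ x, ENNReal.ofReal (g₁ x) ∂μ₁ := by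
  have hΛint : Integrable Λ μ₀ := Integrable.of_bound hΛ.aestronglyMeasurable B
    (Filter.Eventually.of_forall hB)
  have hexpint : Integrable (fun x => Real.exp (Λ x)) μ₀ :=
    Integrable.of_bound (by fun_prop) (Real.exp B) (Filter.Eventually.of_forall fun x => by
      rw [Real.norm_eq_abs, abs_of_pos (Real.exp_pos _)]
      exact Real.exp_le_exp.2 ((le_abs_self _).trans (hB x)))
  have hminint : Integrable (fun x => min 1 (Real.exp (Λ x))) μ₀ :=
    (integrable_const 1).inf hexpint
  have hone : ∫ x, Real.exp (Λ x) ∂μ₀ = 1 := by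
    have h : ∫⁻ x, ENNReal.ofReal (Real.exp (Λ x)) ∂μ₀ = 1 := by
      rw [← setLIntegral_univ, ← withDensity_apply _ MeasurableSet.univ, ← hμ, measure_univ]
    rw [integral_eq_lintegral_of_nonneg_ae (Filter.Eventually.of_forall fun x =>
      (Real.exp_pos _).le) (by fun_prop), h, ENNReal.toReal_one]
  -- The likelihood ratio has mean `1` and `Λ` has mean at least `-1`, so the affine bound has mean
  -- at least `exp (-4) * (1 - 2 / 4)`.
  have hmin : Real.exp (-4) / 2 ≤ ∫ x, min 1 (Real.exp (Λ x)) ∂μ₀ := by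
    calc Real.exp (-4) / 2
        ≤ ∫ x, Real.exp (-4) * (1 + (Λ x - Real.exp (Λ x)) / 4) ∂μ₀ := by
          have hsub : Integrable (fun x => (Λ x - Real.exp (Λ x)) / 4) μ₀ :=
            (hΛint.sub hexpint).div_const 4
          rw [integral_const_mul, integral_add (integrable_const _) hsub, integral_div,
            integral_sub hΛint hexpint, hone]
          simp only [integral_const, probReal_univ, smul_eq_mul, one_mul]
          have := Real.exp_pos (-4)
          nlinarith
      _ ≤ _ := integral_mono
          (((integrable_const _).add ((hΛint.sub hexpint).div_const 4)).const_mul _) hminint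
          fun x => affine_le_min_one_exp _
  -- Under `μ₀` the two losses carry the weights `1` and `exp Λ`, both at least `min 1 (exp Λ)`.
  rw [hμ, lintegral_withDensity_eq_lintegral_mul _ (by fun_prop) (by fun_prop),
    ← lintegral_add_left (by fun_prop)]
  calc ENNReal.ofReal (Δ * (Real.exp (-4) / 2))
      ≤ ENNReal.ofReal (∫ x, Δ * min 1 (Real.exp (Λ x)) ∂μ₀) := by
        rw [integral_const_mul]
        exact ENNReal.ofReal_le_ofReal (mul_le_mul_of_nonneg_left hmin hΔ)
    _ = ∫⁻ x, ENNReal.ofReal (Δ * min 1 (Real.exp (Λ x))) ∂μ₀ :=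
        ofReal_integral_eq_lintegral_ofReal (hminint.const_mul _)
          (Filter.Eventually.of_forall fun x =>
            mul_nonneg hΔ (le_min zero_le_one (Real.exp_pos _).le))
    _ ≤ _ := lintegral_mono fun x => by
        rw [ENNReal.ofReal_mul hΔ]
        set m := ENNReal.ofReal (min 1 (Real.exp (Λ x)))
        have hm1 : m ≤ 1 := by
          rw [← ENNReal.ofReal_one]
          exact ENNReal.ofReal_le_ofReal (min_le_left _ _)
        have hm2 : m ≤ ENNReal.ofReal (Real.exp (Λ x)) :=
          ENNReal.ofReal_le_ofReal (min_le_right _ _)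
        calc ENNReal.ofReal Δ * m
            ≤ (ENNReal.ofReal (g₀ x) + ENNReal.ofReal (g₁ x)) * m := by gcongr; exact hg x
          _ = ENNReal.ofReal (g₀ x) * m + m * ENNReal.ofReal (g₁ x) := by ring
          _ ≤ ENNReal.ofReal (g₀ x) * 1 + ENNReal.ofReal (Real.exp (Λ x)) *
              ENNReal.ofReal (g₁ x) := by gcongr
          _ = _ := by simp [Pi.mul_apply]

/-! ### Likelihood ratio and divergence of the records. -/

section Interaction

variable {d N K H : ℕ} {P : ℝ}

instance (I : Market d N K H P) : IsProbabilityMeasure I.contextLaw := by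
  unfold Market.contextLaw
  infer_instance

/-- The law of the covariates and of the decisions of one period. -/
noncomputable def Market.decisionKernel (I : Market d N K H P) (π : Policy d N K H P) (n : ℕ) :
    Kernel (History d N K H P n) ((Contexts d N H × Action N K P) × (Fin H → Action N K P)) :=
  (Kernel.const _ I.contextLaw ⊗ₖ π.act n) ⊗ₖ I.source.act n

instance (I : Market d N K H P) (π : Policy d N K H P) (n : ℕ) :
    IsMarkovKernel (I.decisionKernel π n) := by
  unfold Market.decisionKernel
  infer_instance

lemma Market.step_eq (I : Market d N K H P) (π : Policy d N K H P) (n : ℕ) :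
    I.step π n = I.decisionKernel π n ⊗ₖ Kernel.prodMkLeft _ (choiceKernel I.ν) := rfl

instance (I : Market d N K H P) (π : Policy d N K H P) (n : ℕ) :
    IsMarkovKernel (I.step π n) := by
  rw [Market.step_eq]
  infer_instance

lemma Market.law_succ (I : Market d N K H P) (π : Policy d N K H P) (n : ℕ) :
    I.law π (n + 1) = (I.law π n) ⊗ₘ (I.step π n) := rfl

instance Market.isProbabilityMeasure_law (I : Market d N K H P) (π : Policy d N K H P) :
    ∀ n, IsProbabilityMeasure (I.law π n)
  | 0 => inferInstanceAs (IsProbabilityMeasure (Measure.dirac () : Measure Unit))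
  | n + 1 => by
    have := Market.isProbabilityMeasure_law I π n
    exact inferInstanceAs (IsProbabilityMeasure ((I.law π n) ⊗ₘ (I.step π n)))

/-- Almost sure properties of the covariates hold almost surely in every period. -/
lemma Market.ae_decisionKernel (I : Market d N K H P) (π : Policy d N K H P) (n : ℕ)
    (h : History d N K H P n) {p : Contexts d N H → Prop} (hp : ∀ᵐ X ∂I.contextLaw, p X) :
    ∀ᵐ z ∂(I.decisionKernel π n h), p z.1.1 := by
  have h1 : (I.decisionKernel π n h).map Prod.fst
      = (Kernel.const _ I.contextLaw ⊗ₖ π.act n) h := by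
    rw [← Kernel.fst_apply, Market.decisionKernel, Kernel.fst_compProd]
  have h2 : ((Kernel.const _ I.contextLaw ⊗ₖ π.act n) h).map Prod.fst = I.contextLaw := by
    rw [← Kernel.fst_apply, Kernel.fst_compProd, Kernel.const_apply]
  rw [← h2] at hp
  have := ae_of_ae_map measurable_fst.aemeasurable hp
  rw [← h1] at this
  exact ae_of_ae_map measurable_fst.aemeasurable this

/-- Almost sure properties of the decisions in the source markets. -/
lemma Market.ae_decisionKernel_source (I : Market d N K H P) (π : Policy d N K H P) (n : ℕ)
    (h : History d N K H P n) {p : Action N K P × (Fin H → Action N K P) → Prop}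
    (hm : MeasurableSet {z | p z}) (hp : ∀ w, ∀ᵐ b ∂(I.source.act n (h, w)), p (w.2, b)) :
    ∀ᵐ z ∂(I.decisionKernel π n h), p (z.1.2, z.2) := by
  unfold Market.decisionKernel
  rw [Kernel.ae_compProd_iff]
  · exact Filter.Eventually.of_forall fun w => hp w
  · exact hm.preimage (by fun_prop)

/-- Almost sure properties of the covariates hold almost surely in every record. -/
lemma Market.ae_law_succ (I : Market d N K H P) (π : Policy d N K H P) (n : ℕ)
    {p : Contexts d N H → Prop} (hp : ∀ᵐ X ∂I.contextLaw, p X) :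
    ∀ᵐ z ∂(I.law π n ⊗ₘ I.step π n), p z.2.1.1.1 := by
  -- The property `p` need not be measurable, so the exceptional set is enlarged to a measurable
  -- null set.
  obtain ⟨s, hs, hsm, hs0⟩ := exists_measurable_superset_of_null hp
  have h1 : ∀ᵐ X ∂I.contextLaw, X ∉ s := by
    rw [ae_iff]
    simpa using hs0
  have h2 : MeasurableSet {z : History d N K H P n × Round d N K H P | z.2.1.1.1 ∉ s} :=
    hsm.compl.preimage (by fun_prop)
  have h3 : ∀ᵐ z ∂(I.law π n ⊗ₘ I.step π n), z.2.1.1.1 ∉ s := by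
    rw [Measure.ae_compProd_iff h2]
    refine Filter.Eventually.of_forall fun h => ?_
    have h4 : MeasurableSet {ρ : Round d N K H P | ρ.1.1.1 ∉ s} :=
      hsm.compl.preimage (by fun_prop)
    rw [Market.step_eq]
    refine Kernel.ae_compProd_of_ae_ae (p := fun ρ : Round d N K H P => ρ.1.1.1 ∉ s) h4 ?_
    filter_upwards [I.ae_decisionKernel π n h h1] with z hz
    exact Filter.Eventually.of_forall fun _ => hz
  filter_upwards [h3] with z hz
  by_contra hc
  exact hz (hs hc)

lemma choiceKernel_apply (ν : Fin (H + 1) → Param d)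
    (z : (Contexts d N H × Action N K P) × (Fin H → Action N K P)) :
    choiceKernel ν z = ∑ y, ENNReal.ofReal (jointChoiceProb ν z y) • Measure.dirac y := rfl

lemma jointChoiceProb_nonneg (ν : Fin (H + 1) → Param d)
    (z : (Contexts d N H × Action N K P) × (Fin H → Action N K P)) (y : Fin (H + 1) → Choice N) :
    0 ≤ jointChoiceProb ν z y :=
  Finset.prod_nonneg fun _ _ => choiceProb_nonneg _ _ _ _

lemma lintegral_choiceKernel (ν : Fin (H + 1) → Param d)
    (z : (Contexts d N H × Action N K P) × (Fin H → Action N K P))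
    {f : (Fin (H + 1) → Choice N) → ℝ≥0∞} (hf : Measurable f) :
    ∫⁻ y, f y ∂(choiceKernel ν z) = ∑ y, ENNReal.ofReal (jointChoiceProb ν z y) * f y := by
  rw [choiceKernel_apply, lintegral_finsetSum_measure]
  refine Finset.sum_congr rfl fun y _ => ?_
  rw [lintegral_smul_measure, lintegral_dirac' _ hf, smul_eq_mul]

lemma integral_choiceKernel (ν : Fin (H + 1) → Param d)
    (z : (Contexts d N H × Action N K P) × (Fin H → Action N K P))
    {f : (Fin (H + 1) → Choice N) → ℝ} (hf : Measurable f) :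
    ∫ y, f y ∂(choiceKernel ν z) = ∑ y, jointChoiceProb ν z y * f y := by
  rw [choiceKernel_apply, integral_finsetSum_measure]
  · refine Finset.sum_congr rfl fun y _ => ?_
    rw [integral_smul_measure, integral_dirac' _ _ hf.stronglyMeasurable, smul_eq_mul,
      ENNReal.toReal_ofReal (jointChoiceProb_nonneg _ _ _)]
  · intro y _
    refine Integrable.smul_measure ?_ ENNReal.ofReal_ne_top
    exact Integrable.of_bound (C := ‖f y‖) hf.aestronglyMeasurable
      ((ae_dirac_iff (measurableSet_le hf.norm measurable_const)).2 le_rfl)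

/-- Two markets whose choice probabilities differ by the factor `exp ℓ`, for almost all
covariates, have laws of one period that differ by this factor. -/
lemma Market.step_withDensity {I₀ I₁ : Market d N K H P} (hcov : I₁.covLaw = I₀.covLaw)
    (hsrc : I₁.source = I₀.source) {ℓ : Round d N K H P → ℝ} (hℓ : Measurable ℓ)
    (hr : ∀ᵐ X ∂I₀.contextLaw, ∀ a b y, jointChoiceProb I₁.ν ((X, a), b) y =
      jointChoiceProb I₀.ν ((X, a), b) y * Real.exp (ℓ (((X, a), b), y)))
    (π : Policy d N K H P) (n : ℕ) (h : History d N K H P n) :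
    I₁.step π n h = (I₀.step π n h).withDensity fun ρ => ENNReal.ofReal (Real.exp (ℓ ρ)) := by
  -- Given the record, covariates and decisions have the same law in both markets; only the
  -- purchases contribute to the likelihood ratio.
  have hdec : I₁.decisionKernel π n = I₀.decisionKernel π n := by
    unfold Market.decisionKernel Market.contextLaw
    rw [hcov, hsrc]
  refine Measure.ext_of_lintegral _ fun φ hφ => ?_
  rw [lintegral_withDensity_eq_lintegral_mul _ (by fun_prop) hφ, Market.step_eq, Market.step_eq,
    Kernel.lintegral_compProd _ _ _ hφ, Kernel.lintegral_compProd _ _ _ (by fun_prop), hdec]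
  refine lintegral_congr_ae ?_
  filter_upwards [I₀.ae_decisionKernel π n h hr] with z hz
  simp only [Kernel.prodMkLeft_apply, Pi.mul_apply]
  rw [lintegral_choiceKernel _ _ (by fun_prop), lintegral_choiceKernel _ _ (by fun_prop)]
  refine Finset.sum_congr rfl fun y _ => ?_
  rw [hz z.1.2 z.2 y, ENNReal.ofReal_mul (jointChoiceProb_nonneg _ _ _), mul_assoc]

/-- Integrals over one period. -/
lemma Market.integral_step_le (I : Market d N K H P) {f : Round d N K H P → ℝ}
    (hf : Measurable f) {B : ℝ} (hB : ∀ ρ, |f ρ| ≤ B)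
    {g : Round d N K H P → ℝ} (hg : Measurable g) {C : ℝ} (hC : ∀ ρ, |g ρ| ≤ C)
    (π : Policy d N K H P) (n : ℕ) (h : History d N K H P n)
    (hfg : ∀ᵐ z ∂(I.decisionKernel π n h), ∑ y, jointChoiceProb I.ν z y * f (z, y)
      ≤ ∑ y, jointChoiceProb I.ν z y * g (z, y)) :
    ∫ ρ, f ρ ∂(I.step π n h) ≤ ∫ ρ, g ρ ∂(I.step π n h) := by
  have hfi : Integrable f (I.step π n h) := Integrable.of_bound hf.aestronglyMeasurable B
    (Filter.Eventually.of_forall hB)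
  have hgi : Integrable g (I.step π n h) := Integrable.of_bound hg.aestronglyMeasurable C
    (Filter.Eventually.of_forall hC)
  rw [Market.step_eq] at hfi hgi ⊢
  rw [integral_compProd hfi, integral_compProd hgi]
  refine integral_mono_ae hfi.integral_compProd hgi.integral_compProd ?_
  filter_upwards [hfg] with z hz
  simp only [Kernel.prodMkLeft_apply]
  rw [integral_choiceKernel _ _ (by fun_prop), integral_choiceKernel _ _ (by fun_prop)]
  exact hz

/-- The sum of a function of the rounds over the record. -/
noncomputable def cumulative (ℓ : Round d N K H P → ℝ) : ∀ n, History d N K H P n → ℝ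
  | 0 => fun _ => 0
  | n + 1 => fun h : History d N K H P n × Round d N K H P => cumulative ℓ n h.1 + ℓ h.2

lemma measurable_cumulative {ℓ : Round d N K H P → ℝ} (hℓ : Measurable ℓ) :
    ∀ n, Measurable (cumulative ℓ n)
  | 0 => measurable_const
  | n + 1 => ((measurable_cumulative hℓ n).comp measurable_fst).add (hℓ.comp measurable_snd)

lemma abs_cumulative_le {ℓ : Round d N K H P → ℝ} {B : ℝ} (hB : ∀ ρ, |ℓ ρ| ≤ B) :
    ∀ n h, |cumulative ℓ n h| ≤ n * B
  | 0, _ => by simp [cumulative]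
  | n + 1, h => by
    have h1 := abs_cumulative_le hB n h.1
    have h2 := hB h.2
    have h3 : cumulative ℓ (n + 1) h = cumulative ℓ n h.1 + ℓ h.2 := rfl
    have h4 := abs_add_le (cumulative ℓ n h.1) (ℓ h.2)
    rw [h3]
    push_cast
    linarith

/-- The densities of the successive periods multiply, so their logarithms add up along the record.
-/
lemma Market.law_withDensity {I₀ I₁ : Market d N K H P} {ℓ : Round d N K H P → ℝ}
    (hℓ : Measurable ℓ) (π : Policy d N K H P)
    (hstep : ∀ n h, I₁.step π n h =
      (I₀.step π n h).withDensity fun ρ => ENNReal.ofReal (Real.exp (ℓ ρ))) :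
    ∀ n, I₁.law π n =
      (I₀.law π n).withDensity fun h => ENNReal.ofReal (Real.exp (cumulative ℓ n h))
  | 0 => by
    have h : (fun h : History d N K H P 0 => ENNReal.ofReal (Real.exp (cumulative ℓ 0 h))) = 1 := by
      funext h
      simp [cumulative]
    rw [h, withDensity_one]
    rfl
  | n + 1 => by
    have hm := measurable_cumulative hℓ n
    rw [Market.law_succ, Market.law_withDensity hℓ π hstep n,
      Measure.compProd_withDensity_mul _ _ _ (by fun_prop) (by fun_prop) (hstep n),
      Market.law_succ]
    congr 1
    funext z
    rw [← ENNReal.ofReal_mul (Real.exp_pos _).le, ← Real.exp_add]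
    rfl

/-- Chain rule for the divergence: if `v` dominates the conditional divergence of each period, the
divergence of the whole record is at most the sum of the expectations of `v`. -/
lemma Market.integral_cumulative (I : Market d N K H P) (π : Policy d N K H P)
    {ℓ : Round d N K H P → ℝ} (hℓ : Measurable ℓ) {B : ℝ} (hB : ∀ ρ, |ℓ ρ| ≤ B)
    {v : Round d N K H P → ℝ} (hv : Measurable v) {C : ℝ} (hC : ∀ ρ, |v ρ| ≤ C)
    (hℓv : ∀ n h, ∫ ρ, - ℓ ρ ∂(I.step π n h) ≤ ∫ ρ, v ρ ∂(I.step π n h)) :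
    ∀ n, - ∑ k ∈ Finset.range n,
      ∫ h : History d N K H P k × Round d N K H P, v h.2 ∂(I.law π k ⊗ₘ I.step π k)
        ≤ ∫ h, cumulative ℓ n h ∂(I.law π n)
  | 0 => by simp [cumulative]
  | n + 1 => by
    have ih := Market.integral_cumulative I π hℓ hB hv hC hℓv n
    have hm := measurable_cumulative hℓ n
    have hi1 : Integrable (fun z : History d N K H P n × Round d N K H P => cumulative ℓ n z.1)
        (I.law π n ⊗ₘ I.step π n) := Integrable.of_bound (hm.comp measurable_fst).aestronglyMeasurable (n * B)
      (Filter.Eventually.of_forall fun z => abs_cumulative_le hB n z.1)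
    have hi2 : Integrable (fun z : History d N K H P n × Round d N K H P => ℓ z.2)
        (I.law π n ⊗ₘ I.step π n) := Integrable.of_bound (hℓ.comp measurable_snd).aestronglyMeasurable B
      (Filter.Eventually.of_forall fun z => hB z.2)
    have hi3 : Integrable (fun z : History d N K H P n × Round d N K H P => v z.2)
        (I.law π n ⊗ₘ I.step π n) := Integrable.of_bound (hv.comp measurable_snd).aestronglyMeasurable C
      (Filter.Eventually.of_forall fun z => hC z.2)
    have hsum : ∫ h, cumulative ℓ (n + 1) h ∂(I.law π (n + 1))
        = ∫ h, cumulative ℓ n h ∂(I.law π n)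
          + ∫ z : History d N K H P n × Round d N K H P, ℓ z.2 ∂(I.law π n ⊗ₘ I.step π n) := by
      rw [Market.law_succ]
      change ∫ z : History d N K H P n × Round d N K H P, (cumulative ℓ n z.1 + ℓ z.2)
        ∂(I.law π n ⊗ₘ I.step π n) = _
      rw [integral_add hi1 hi2, Measure.integral_compProd hi1]
      simp
    have hle : - ∫ z : History d N K H P n × Round d N K H P, ℓ z.2 ∂(I.law π n ⊗ₘ I.step π n)
        ≤ ∫ z : History d N K H P n × Round d N K H P, v z.2 ∂(I.law π n ⊗ₘ I.step π n) := by
      have hi4 : Integrable (fun z : History d N K H P n × Round d N K H P => - ℓ z.2)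
        (I.law π n ⊗ₘ I.step π n) := hi2.neg
      rw [← integral_neg, Measure.integral_compProd hi4, Measure.integral_compProd hi3]
      exact integral_mono
        (MeasureTheory.Integrable.integral_compProd
          (κ := Kernel.const Unit (I.law π n)) (η := Kernel.prodMkLeft Unit (I.step π n)) hi4)
        (MeasureTheory.Integrable.integral_compProd
          (κ := Kernel.const Unit (I.law π n)) (η := Kernel.prodMkLeft Unit (I.step π n)) hi3) fun h => hℓv n h
    rw [hsum, Finset.sum_range_succ]
    linarith

/-- Two-point lower bound for sequential decisions. -/
theorem Market.two_point_period {I₀ I₁ : Market d N K H P} (π : Policy d N K H P)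
    {ℓ : Round d N K H P → ℝ} (hℓ : Measurable ℓ) {B : ℝ} (hB : ∀ ρ, |ℓ ρ| ≤ B)
    (hstep : ∀ n h, I₁.step π n h =
      (I₀.step π n h).withDensity fun ρ => ENNReal.ofReal (Real.exp (ℓ ρ)))
    {v : Round d N K H P → ℝ} (hv : Measurable v) {C : ℝ} (hv0 : ∀ ρ, 0 ≤ v ρ)
    (hC : ∀ ρ, v ρ ≤ C)
    (hℓv : ∀ n h, ∫ ρ, - ℓ ρ ∂(I₀.step π n h) ≤ ∫ ρ, v ρ ∂(I₀.step π n h)) {T : ℕ}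
    (hT : ∑ n ∈ Finset.range T, ∫⁻ h : History d N K H P n × Round d N K H P,
      ENNReal.ofReal (v h.2) ∂(I₀.law π n ⊗ₘ I₀.step π n) ≤ 1)
    {g₀ g₁ : Round d N K H P → ℝ} (hg₀ : Measurable g₀) (hg₁ : Measurable g₁)
    {Δ : ℝ} (hΔ : 0 ≤ Δ) (hg : ∀ ρ, ENNReal.ofReal Δ ≤ ENNReal.ofReal (g₀ ρ) +
      ENNReal.ofReal (g₁ ρ)) {n : ℕ} (hn : n < T) :
    ENNReal.ofReal (Δ * (Real.exp (-4) / 2)) ≤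
      ∫⁻ h : History d N K H P n × Round d N K H P, ENNReal.ofReal (g₀ h.2) ∂(I₀.law π n ⊗ₘ I₀.step π n) +
      ∫⁻ h : History d N K H P n × Round d N K H P, ENNReal.ofReal (g₁ h.2)
        ∂(I₁.law π n ⊗ₘ I₁.step π n) := by
  refine two_point_bound (α := History d N K H P n × Round d N K H P) (I₀.law π n ⊗ₘ I₀.step π n)
    (I₁.law π n ⊗ₘ I₁.step π n) (measurable_cumulative hℓ (n + 1)) (abs_cumulative_le hB (n + 1))
    (Market.law_withDensity hℓ π hstep (n + 1)) ?_ (hg₀.comp measurable_snd)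
    (hg₁.comp measurable_snd) hΔ fun x => hg x.2
  refine le_trans ?_ (I₀.integral_cumulative π hℓ hB hv
    (fun ρ => (abs_of_nonneg (hv0 ρ)).trans_le (hC ρ)) hℓv (n + 1))
  rw [neg_le_neg_iff]
  have hconv : ∀ k, ENNReal.ofReal (∫ h : History d N K H P k × Round d N K H P, v h.2
      ∂(I₀.law π k ⊗ₘ I₀.step π k)) = ∫⁻ h : History d N K H P k × Round d N K H P,
      ENNReal.ofReal (v h.2) ∂(I₀.law π k ⊗ₘ I₀.step π k) := fun k =>
    ofReal_integral_eq_lintegral_ofReal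
      (Integrable.of_bound (hv.comp measurable_snd).aestronglyMeasurable C
        (Filter.Eventually.of_forall fun h =>
          (abs_of_nonneg (hv0 h.2)).trans_le (hC h.2)))
      (Filter.Eventually.of_forall fun h => hv0 h.2)
  have h1 : ENNReal.ofReal (∑ k ∈ Finset.range (n + 1),
      ∫ h : History d N K H P k × Round d N K H P, v h.2 ∂(I₀.law π k ⊗ₘ I₀.step π k)) ≤ 1 := by
    rw [ENNReal.ofReal_sum_of_nonneg fun k _ => integral_nonneg fun h => hv0 _]
    simp only [hconv]
    -- The loss of period `n` is seen in the record of `n + 1 ≤ T` periods, whose information is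
    -- within the budget for `T`.
    exact (Finset.sum_le_sum_of_subset (Finset.range_subset_range.2 hn)).trans hT
  exact ENNReal.ofReal_le_one.1 h1

end Interaction

/-! ### Divergence of multinomial logit choices. -/

section Likelihood

variable {d N K H : ℕ} {P : ℝ}

/-- The change of the utility of a product when the parameter `ν` is replaced by `ν'`. -/
noncomputable def utilityShift (ν ν' : Param d) (X : Covariates d N) (a : Action N K P)
    (i : Fin N) : ℝ :=
  utility ν' (X i) (a.2 i) - utility ν (X i) (a.2 i)

/-- The log-likelihood ratio of a choice under `ν'` with respect to `ν`. -/
noncomputable def logLik (ν ν' : Param d) (X : Covariates d N) (a : Action N K P)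
    (y : Choice N) : ℝ :=
  y.elim 0 (utilityShift ν ν' X a) - (Real.log (logitDenom ν' X a) - Real.log (logitDenom ν X a))

lemma choiceProb_eq_mul_exp_logLik (ν ν' : Param d) (X : Covariates d N) (a : Action N K P)
    (y : Choice N) :
    choiceProb ν' X a y = choiceProb ν X a y * Real.exp (logLik ν ν' X a y) := by
  have h := logitDenom_pos ν X a
  have h' := logitDenom_pos ν' X a
  have hlog : Real.exp (Real.log (logitDenom ν' X a) - Real.log (logitDenom ν X a))
      = logitDenom ν' X a / logitDenom ν X a := by
    rw [Real.exp_sub, Real.exp_log h', Real.exp_log h]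
  unfold logLik
  rw [Real.exp_sub, hlog]
  cases y with
  | none =>
    simp only [choiceProb, Option.elim_none, Real.exp_zero]
    field_simp
  | some i =>
    simp only [choiceProb, Option.elim_some]
    split_ifs
    · rw [utilityShift, Real.exp_sub]
      have := Real.exp_pos (utility ν (X i) (a.2 i))
      field_simp
    · simp

lemma logitDenom_le_exp_mul (ν ν' : Param d) (X : Covariates d N) (a : Action N K P)
    (h : ∀ i, utilityShift ν ν' X a i ≤ 1) :
    logitDenom ν' X a ≤ Real.exp 1 * logitDenom ν X a := by
  unfold logitDenom
  rw [mul_add, Finset.mul_sum]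
  refine add_le_add ?_ (Finset.sum_le_sum fun i _ => ?_)
  · have := Real.add_one_le_exp 1
    linarith
  · rw [← Real.exp_add, Real.exp_le_exp]
    have := h i
    unfold utilityShift at this
    linarith

/-- The utility term and the logarithm of the ratio of the normalizers each lie in `[-1, 1]`. -/
lemma abs_logLik_le (ν ν' : Param d) (X : Covariates d N) (a : Action N K P)
    (h : ∀ i, |utilityShift ν ν' X a i| ≤ 1) (y : Choice N) : |logLik ν ν' X a y| ≤ 2 := by
  have h0 := logitDenom_pos ν X a
  have h0' := logitDenom_pos ν' X a
  have h1 := Real.log_le_log h0'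
    (logitDenom_le_exp_mul ν ν' X a fun i => (le_abs_self _).trans (h i))
  have h2 := Real.log_le_log h0 (logitDenom_le_exp_mul ν' ν X a fun i => by
    have := neg_abs_le (utilityShift ν ν' X a i)
    have := h i
    unfold utilityShift at *
    linarith)
  rw [Real.log_mul (Real.exp_pos 1).ne' h0.ne', Real.log_exp] at h1
  rw [Real.log_mul (Real.exp_pos 1).ne' h0'.ne', Real.log_exp] at h2
  have h3 : |y.elim 0 (utilityShift ν ν' X a)| ≤ 1 := by
    cases y with
    | none => simp
    | some i => exact h i
  rw [abs_le] at h3 ⊢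
  unfold logLik
  constructor <;> linarith [h3.1, h3.2]

/-- The Kullback–Leibler divergence of two multinomial logit choices. -/
lemma sum_choiceProb_mul_neg_logLik_le (ν ν' : Param d) (X : Covariates d N) (a : Action N K P)
    (h : ∀ i, |utilityShift ν ν' X a i| ≤ 1) :
    ∑ y, choiceProb ν X a y * -logLik ν ν' X a y ≤ ∑ i ∈ a.1.1, utilityShift ν ν' X a i ^ 2 := by
  have h0 := logitDenom_pos ν X a
  have h0' := logitDenom_pos ν' X a
  set D := Real.log (logitDenom ν' X a) - Real.log (logitDenom ν X a) with hD
  have hsum : ∑ y, choiceProb ν X a y * -logLik ν ν' X a y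
      = D - ∑ i ∈ a.1.1, choiceProb ν X a (some i) * utilityShift ν ν' X a i := by
    have h1 : ∀ y, choiceProb ν X a y * -logLik ν ν' X a y = choiceProb ν X a y * D
        - choiceProb ν X a y * y.elim 0 (utilityShift ν ν' X a) := fun y => by
      unfold logLik
      ring
    simp only [h1]
    rw [Finset.sum_sub_distrib, ← Finset.sum_mul, sum_choiceProb, one_mul,
      Fintype.sum_option]
    simp [choiceProb, Finset.sum_ite_mem]
  -- By `log r ≤ r - 1`. The terms linear in the shift then cancel against those in `hsum`, leaving
  -- `exp s - 1 - s ≤ s ^ 2`.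
  have hDle : D ≤ ∑ i ∈ a.1.1, choiceProb ν X a (some i) *
      (Real.exp (utilityShift ν ν' X a i) - 1) := by
    rw [hD, ← Real.log_div h0'.ne' h0.ne']
    refine (Real.log_le_sub_one_of_pos (div_pos h0' h0)).trans (le_of_eq ?_)
    have h2 : ∀ i ∈ a.1.1, choiceProb ν X a (some i) * (Real.exp (utilityShift ν ν' X a i) - 1)
        = (Real.exp (utility ν' (X i) (a.2 i)) - Real.exp (utility ν (X i) (a.2 i)))
          / logitDenom ν X a := fun i hi => by
      simp only [choiceProb, if_pos hi, utilityShift, Real.exp_sub]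
      have := Real.exp_pos (utility ν (X i) (a.2 i))
      field_simp
    rw [Finset.sum_congr rfl h2, ← Finset.sum_div, Finset.sum_sub_distrib, div_sub_one h0.ne']
    congr 1
    unfold logitDenom
    ring
  have hq : ∀ i, choiceProb ν X a (some i) ≤ 1 := fun i => by
    rw [← sum_choiceProb ν X a]
    exact Finset.single_le_sum (fun y _ => choiceProb_nonneg ν X a y) (Finset.mem_univ _)
  calc _ ≤ ∑ i ∈ a.1.1, choiceProb ν X a (some i) * (Real.exp (utilityShift ν ν' X a i) - 1)
        - ∑ i ∈ a.1.1, choiceProb ν X a (some i) * utilityShift ν ν' X a i := by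
        rw [hsum]
        linarith
    _ = ∑ i ∈ a.1.1, choiceProb ν X a (some i) *
        (Real.exp (utilityShift ν ν' X a i) - 1 - utilityShift ν ν' X a i) := by
        rw [← Finset.sum_sub_distrib]
        exact Finset.sum_congr rfl fun i _ => by ring
    _ ≤ _ := Finset.sum_le_sum fun i _ => by
        have h3 := (abs_le.1 (Real.abs_exp_sub_one_sub_id_le (h i))).2
        have h4 := choiceProb_nonneg ν X a (some i)
        have h5 := hq i
        nlinarith [sq_nonneg (utilityShift ν ν' X a i)]

lemma measurable_utilityShift (ν ν' : Param d) (X : Covariates d N) (i : Fin N) :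
    Measurable fun a : Action N K P => utilityShift ν ν' X a i := by
  unfold utilityShift utility
  fun_prop

lemma measurable_log_logitDenom (ν : Param d) (X : Covariates d N) :
    Measurable fun a : Action N K P => Real.log (logitDenom ν X a) := by
  have h := (measurable_logitDenom (N := N) (K := K) (P := P) ν).comp
    (measurable_prodMk_left (x := X))
  exact Real.measurable_log.comp h

lemma measurable_logLik_right (ν ν' : Param d) (X : Covariates d N) (y : Choice N) :
    Measurable fun a : Action N K P => logLik ν ν' X a y := by
  unfold logLik
  refine Measurable.sub ?_
    ((measurable_log_logitDenom ν' X).sub (measurable_log_logitDenom ν X))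
  cases y with
  | none => exact measurable_const
  | some i => exact measurable_utilityShift ν ν' X i

lemma measurable_logLik (ν ν' : Param d) (X : Covariates d N) :
    Measurable fun z : Action N K P × Choice N => logLik ν ν' X z.1 z.2 :=
  measurable_from_prod_countable_left fun y => measurable_logLik_right ν ν' X y

/-- Expectation of a sum of functions of independent choices. -/
lemma sum_prod_mul_sum {ι α : Type*} [Fintype ι] [DecidableEq ι] [Fintype α]
    (q g : ι → α → ℝ) (hq : ∀ i, ∑ y, q i y = 1) :
    ∑ y : ι → α, (∏ i, q i (y i)) * ∑ i, g i (y i) = ∑ i, ∑ y, q i y * g i y := by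
  simp only [Finset.mul_sum]
  rw [Finset.sum_comm]
  refine Finset.sum_congr rfl fun i _ => ?_
  -- Writing the summand as a product over all coordinates lets the sum over `y` factorize; the
  -- factors other than `i` sum to `1`.
  have h1 : ∀ y : ι → α, (∏ j, q j (y j)) * g i (y i)
      = ∏ j, (q j (y j) * if j = i then g j (y j) else 1) := fun y => by
    rw [Finset.prod_mul_distrib]
    simp
  have h2 := Finset.prod_univ_sum (fun _ : ι => (Finset.univ : Finset α))
    fun j y => q j y * if j = i then g j y else 1
  rw [Fintype.piFinset_univ] at h2
  simp only [h1, ← h2]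
  rw [Finset.prod_eq_single i]
  · simp
  · intro j _ hj
    simp [hj, hq]
  · simp

/-- The log-likelihood ratio of the choices in all markets, when all covariates are `X`. -/
noncomputable def jointLogLik (ν ν' : Fin (H + 1) → Param d) (X : Covariates d N)
    (ρ : Round d N K H P) : ℝ :=
  ∑ h, logLik (ν h) (ν' h) X (decisions ρ.1.1.2 ρ.1.2 h) (ρ.2 h)

lemma measurable_jointLogLik (ν ν' : Fin (H + 1) → Param d) (X : Covariates d N) :
    Measurable (jointLogLik (K := K) (P := P) ν ν' X) := by
  unfold jointLogLik
  refine Finset.measurable_fun_sum _ fun h _ => ?_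
  have h1 : Measurable fun ρ : Round d N K H P => decisions ρ.1.1.2 ρ.1.2 h :=
    (measurable_decisions h).comp measurable_fst
  have h2 : Measurable fun ρ : Round d N K H P => ρ.2 h :=
    (measurable_pi_apply h).comp measurable_snd
  exact (measurable_logLik (ν h) (ν' h) X).comp (h1.prodMk h2)

lemma abs_jointLogLik_le (ν ν' : Fin (H + 1) → Param d) (X : Covariates d N)
    (h : ∀ h, ∀ a : Action N K P, ∀ i, |utilityShift (ν h) (ν' h) X a i| ≤ 1)
    (ρ : Round d N K H P) : |jointLogLik ν ν' X ρ| ≤ (H + 1) * 2 := by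
  refine (Finset.abs_sum_le_sum_abs _ _).trans ?_
  refine (Finset.sum_le_sum fun i _ => abs_logLik_le _ _ _ _ (h i _) _).trans (le_of_eq ?_)
  simp

/-- Covariates that are indistinguishable from `X₀` for both parameters may be frozen at `X₀`, so
the likelihood ratio depends on decisions and purchases only. -/
lemma jointChoiceProb_eq_mul_exp {ν ν' : Fin (H + 1) → Param d} {X : Contexts d N H}
    {X₀ : Covariates d N} (hX : ∀ h (a : Action N K P) y,
      choiceProb (ν h) (X h) a y = choiceProb (ν h) X₀ a y ∧
      choiceProb (ν' h) (X h) a y = choiceProb (ν' h) X₀ a y)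
    (a : Action N K P) (b : Fin H → Action N K P) (y : Fin (H + 1) → Choice N) :
    jointChoiceProb ν' ((X, a), b) y =
      jointChoiceProb ν ((X, a), b) y * Real.exp (jointLogLik ν ν' X₀ (((X, a), b), y)) := by
  unfold jointChoiceProb jointLogLik
  rw [Real.exp_sum, ← Finset.prod_mul_distrib]
  refine Finset.prod_congr rfl fun h _ => ?_
  rw [(hX h _ _).1, (hX h _ _).2, choiceProb_eq_mul_exp_logLik (ν h)]

lemma sum_jointChoiceProb_mul_neg_jointLogLik_le {ν ν' : Fin (H + 1) → Param d}
    {X : Contexts d N H} {X₀ : Covariates d N} (hX : ∀ h (a : Action N K P) y,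
      choiceProb (ν h) (X h) a y = choiceProb (ν h) X₀ a y)
    (hs : ∀ h, ∀ a : Action N K P, ∀ i, |utilityShift (ν h) (ν' h) X₀ a i| ≤ 1)
    (a : Action N K P) (b : Fin H → Action N K P) :
    ∑ y, jointChoiceProb ν ((X, a), b) y * -jointLogLik ν ν' X₀ (((X, a), b), y) ≤
      ∑ h, ∑ i ∈ (decisions a b h).1.1, utilityShift (ν h) (ν' h) X₀ (decisions a b h) i ^ 2 := by
  have h1 := sum_prod_mul_sum (fun h y => choiceProb (ν h) X₀ (decisions a b h) y)
    (fun h y => -logLik (ν h) (ν' h) X₀ (decisions a b h) y) fun h => sum_choiceProb _ _ _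
  have h2 : ∑ y, jointChoiceProb ν ((X, a), b) y * -jointLogLik ν ν' X₀ (((X, a), b), y)
      = ∑ y : Fin (H + 1) → Choice N, (∏ h, choiceProb (ν h) X₀ (decisions a b h) (y h)) *
        ∑ h, -logLik (ν h) (ν' h) X₀ (decisions a b h) (y h) := by
    refine Finset.sum_congr rfl fun y _ => ?_
    unfold jointChoiceProb jointLogLik
    rw [Finset.sum_neg_distrib]
    congr 1
    exact Finset.prod_congr rfl fun h _ => hX h _ _
  rw [h2, h1]
  exact Finset.sum_le_sum fun h _ => sum_choiceProb_mul_neg_logLik_le _ _ _ _ (hs h _)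

end Likelihood

/-! ### Revenue near the optimal price, in both models. -/

section Revenue

/-- A quadratic lower bound of `exp s - 1 - s` on `[-B, B]`. -/
lemma sq_div_le_exp_sub {s B : ℝ} (hB : 1 ≤ B) (hs : |s| ≤ B) :
    s ^ 2 / (4 * B) ≤ Real.exp s - 1 - s := by
  rw [div_le_iff₀ (by positivity)]
  -- For `s ≥ -2`, squaring `1 + s / 2 ≤ exp (s / 2)` gives the constant `1 / 4`. For `s < -2`, the
  -- linear term `-1 - s` suffices, as `|s| ≤ B`.
  rcases le_or_gt (-2) s with h | h
  · have h1 := Real.add_one_le_exp (s / 2)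
    have h2 : Real.exp s = Real.exp (s / 2) * Real.exp (s / 2) := by
      rw [← Real.exp_add, add_halves]
    have h3 : s ^ 2 / 4 ≤ Real.exp s - 1 - s := by nlinarith
    nlinarith [sq_nonneg s]
  · have h1 := Real.exp_pos s
    have h2 := (abs_le.1 hs).1
    nlinarith

/-- Existence of the optimal markup of a multinomial logit model with `m` products. -/
lemma exists_markup {m : ℝ} (hm : 1 ≤ m) :
    ∃ u, 1 ≤ u ∧ u ≤ 2 + Real.log m ∧ u = 1 + m * Real.exp (-u) := by
  have hm0 : 0 < m := by linarith
  have hlog := Real.log_nonneg hm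
  have hcont : ContinuousOn (fun u : ℝ => u - 1 - m * Real.exp (-u)) (Set.Icc 1 (2 + Real.log m)) :=
    by fun_prop
  have h := intermediate_value_Icc (by linarith) hcont
  -- The right endpoint `2 + log m` makes `m exp(-u)` equal to `exp (-2) ≤ 1`.
  have h0 : (0 : ℝ) ∈ Set.Icc (1 - 1 - m * Real.exp (-1))
      (2 + Real.log m - 1 - m * Real.exp (-(2 + Real.log m))) := by
    constructor
    · have := Real.exp_pos (-1)
      nlinarith
    · have h1 : m * Real.exp (-(2 + Real.log m)) = Real.exp (-2) := by
        rw [neg_add, Real.exp_add, Real.exp_neg (Real.log m), Real.exp_log hm0]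
        field_simp
      have h2 : Real.exp (-2) ≤ 1 := Real.exp_le_one_iff.2 (by norm_num)
      rw [h1]
      linarith
  obtain ⟨u, hu, hu0⟩ := h h0
  refine ⟨u, hu.1, hu.2, ?_⟩
  simp only at hu0
  linarith

variable {ι : Type*} {S : Finset ι} {p : ι → ℝ} {m b u P δ : ℝ}

/-- The revenue that a model with utilities `-b p` loses by prices other than `u / b`. -/
lemma quadratic_revenue_loss (hS : (S.card : ℝ) ≤ m) (hb0 : 0 < b)
    (hb1 : b ≤ 1) (hu1 : 1 ≤ u) (hu : u = 1 + m * Real.exp (-u)) (hP : 1 ≤ P) (huP : u / b ≤ P)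
    (hp : ∀ i ∈ S, 0 ≤ p i ∧ p i ≤ P) :
    b * Real.exp (-u) * Real.exp (-P) / (4 * P * (1 + m)) * ∑ i ∈ S, (p i - u / b) ^ 2 ≤
      m * Real.exp (-u) / b - (∑ i ∈ S, p i * Real.exp (-(b * p i))) /
        (1 + ∑ i ∈ S, Real.exp (-(b * p i))) := by
  set w := Real.exp (-u) with hw
  have hw0 : 0 < w := Real.exp_pos _
  have hm0 : 0 ≤ m := (Nat.cast_nonneg _).trans hS
  set Z := 1 + ∑ i ∈ S, Real.exp (-(b * p i)) with hZ
  have hZ1 : 1 ≤ Z := by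
    have : 0 ≤ ∑ i ∈ S, Real.exp (-(b * p i)) := Finset.sum_nonneg fun i _ => (Real.exp_pos _).le
    linarith
  have hZm : Z ≤ 1 + m := by
    have : ∑ i ∈ S, Real.exp (-(b * p i)) ≤ ∑ i ∈ S, 1 := Finset.sum_le_sum fun i hi =>
      Real.exp_le_one_iff.2 (by nlinarith [hp i hi])
    simp only [Finset.sum_const, nsmul_eq_mul, mul_one] at this
    linarith
  -- With `t = p i - u / b`, the equation for `u` turns the subtracted term into `w / b * (exp (-b
  -- t) * (1 + b t))`, which is maximal at `t = 0`.
  have hterm : ∀ i ∈ S, b * w * Real.exp (-P) / (4 * P) * (p i - u / b) ^ 2 ≤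
      w / b - Real.exp (-(b * p i)) * (p i - m * w / b) := fun i hi => by
    set t := p i - u / b with ht
    have htP : |b * t| ≤ P := by
      have h1 : |t| ≤ P := by
        have : 0 ≤ u / b := by positivity
        rw [abs_le, ht]
        constructor <;> linarith [(hp i hi).1, (hp i hi).2]
      rw [abs_mul, abs_of_pos hb0]
      nlinarith [abs_nonneg t]
    have h1 := sq_div_le_exp_sub hP htP
    have hpi : b * p i = u + b * t := by rw [ht]; field_simp; ring
    have hpi2 : p i - m * w / b = (1 + b * t) / b := by
      field_simp
      linarith
    have hexp : Real.exp (-(b * p i)) = w * Real.exp (-(b * t)) := by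
      rw [hpi, neg_add, Real.exp_add]
    have h3 : Real.exp (-P) ≤ Real.exp (-(b * t)) :=
      Real.exp_le_exp.2 (neg_le_neg ((le_abs_self _).trans htP))
    have h4 : Real.exp (-(b * t)) * Real.exp (b * t) = 1 := by
      rw [← Real.exp_add]; simp
    have h5 : Real.exp (-P) * ((b * t) ^ 2 / (4 * P)) ≤
        1 - Real.exp (-(b * t)) * (1 + b * t) := by
      calc _ ≤ Real.exp (-(b * t)) * (Real.exp (b * t) - 1 - b * t) :=
            mul_le_mul h3 h1 (by positivity) (Real.exp_pos _).le
        _ = _ := by rw [mul_sub, mul_sub, h4]; ring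
    rw [hexp, hpi2]
    calc _ = w / b * (Real.exp (-P) * ((b * t) ^ 2 / (4 * P))) := by field_simp
      _ ≤ w / b * (1 - Real.exp (-(b * t)) * (1 + b * t)) := by gcongr
      _ = _ := by ring
  have hsum := Finset.sum_le_sum hterm
  rw [← Finset.mul_sum, Finset.sum_sub_distrib] at hsum
  simp only [Finset.sum_const, nsmul_eq_mul] at hsum
  -- As in fractional programming, multiplying the loss by the denominator makes it a sum over
  -- products, with the candidate optimum `m * w / b` subtracted from each price.
  have hnum : m * w / b - (∑ i ∈ S, p i * Real.exp (-(b * p i))) / Z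
      = (m * w / b - ∑ i ∈ S, Real.exp (-(b * p i)) * (p i - m * w / b)) / Z := by
    have h1 : ∑ i ∈ S, Real.exp (-(b * p i)) * (p i - m * w / b)
        = ∑ i ∈ S, p i * Real.exp (-(b * p i)) - (Z - 1) * (m * w / b) := by
      rw [hZ, add_sub_cancel_left, Finset.sum_mul, ← Finset.sum_sub_distrib]
      exact Finset.sum_congr rfl fun i _ => by ring
    rw [h1, eq_div_iff (by linarith), sub_mul, div_mul_cancel₀ _ (by linarith)]
    ring
  rw [hnum]
  set V := ∑ i ∈ S, (p i - u / b) ^ 2 with hV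
  have hV0 : 0 ≤ V := Finset.sum_nonneg fun i _ => sq_nonneg _
  have hP0 : 0 < P := by linarith
  have hle : b * w * Real.exp (-P) / (4 * P) * V ≤
      m * w / b - ∑ i ∈ S, Real.exp (-(b * p i)) * (p i - m * w / b) := by
    have h2 : (S.card : ℝ) * (w / b) ≤ m * w / b := by
      rw [mul_div_assoc]
      exact mul_le_mul_of_nonneg_right hS (by positivity)
    linarith
  have hZ0 : 0 < Z := by linarith
  calc _ = b * w * Real.exp (-P) / (4 * P) * V / (1 + m) := by field_simp
    _ ≤ b * w * Real.exp (-P) / (4 * P) * V / Z :=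
        div_le_div_of_nonneg_left (by positivity) hZ0 hZm
    _ ≤ _ := div_le_div_of_nonneg_right hle hZ0.le

/-- In the perturbed model, prices near `u / b` give little more than the optimal revenue of the
unperturbed model. -/
lemma perturbed_revenue_le (hS : (S.card : ℝ) ≤ m) (hb0 : 0 < b)
    (hu1 : 1 ≤ u) (hu : u = 1 + m * Real.exp (-u)) (hδ0 : 0 ≤ δ)
    (hp : ∀ i ∈ S, δ * |p i - u / b| ≤ 1) :
    (∑ i ∈ S, p i * Real.exp (-(b * p i) - δ * (p i - u / b))) /
        (1 + ∑ i ∈ S, Real.exp (-(b * p i) - δ * (p i - u / b))) ≤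
      m * Real.exp (-u) / b + 2 * δ / b * ∑ i ∈ S, |p i - u / b| := by
  set w := Real.exp (-u) with hw
  have hw0 : 0 < w := Real.exp_pos _
  have hw1 : w ≤ 1 := Real.exp_le_one_iff.2 (by linarith)
  set Z := 1 + ∑ i ∈ S, Real.exp (-(b * p i) - δ * (p i - u / b)) with hZ
  have hZ1 : 1 ≤ Z := by
    have : 0 ≤ ∑ i ∈ S, Real.exp (-(b * p i) - δ * (p i - u / b)) :=
      Finset.sum_nonneg fun i _ => (Real.exp_pos _).le
    linarith
  have hterm : ∀ i ∈ S, Real.exp (-(b * p i) - δ * (p i - u / b)) * (p i - m * w / b) ≤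
      w / b + 2 * δ / b * |p i - u / b| := fun i hi => by
    have hδt := hp i hi
    set t := p i - u / b with ht
    have hpi : b * p i = u + b * t := by rw [ht]; field_simp; ring
    have hpi2 : p i - m * w / b = (1 + b * t) / b := by
      field_simp
      linarith
    have hexp : Real.exp (-(b * p i) - δ * t) = w * (Real.exp (-(b * t)) * Real.exp (-(δ * t))) := by
      rw [hpi, ← Real.exp_add, hw, ← Real.exp_add]
      congr 1
      ring
    have h1 : Real.exp (-(b * t)) * (1 + b * t) ≤ 1 := by
      have h2 := Real.add_one_le_exp (b * t)
      have h4 : Real.exp (-(b * t)) * Real.exp (b * t) = 1 := by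
        rw [← Real.exp_add]; simp
      nlinarith [Real.exp_pos (-(b * t))]
    -- The perturbation multiplies the attraction by this factor only, so it adds an error linear in
    -- `δ |t|`.
    have h2 : Real.exp (-(δ * t)) ≤ 1 + 2 * (δ * |t|) := by
      have h3 : |-(δ * t)| = δ * |t| := by rw [abs_neg, abs_mul, abs_of_nonneg hδ0]
      have h4 := (abs_le.1 (Real.abs_exp_sub_one_le (x := -(δ * t)) (by rw [h3]; exact hδt))).2
      rw [h3] at h4
      linarith
    have h3 : Real.exp (-(b * t)) * Real.exp (-(δ * t)) * (1 + b * t) ≤ 1 + 2 * (δ * |t|) := by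
      have h5 : 0 ≤ δ * |t| := by positivity
      have h6 := Real.exp_pos (-(δ * t))
      nlinarith
    rw [hexp, hpi2]
    calc _ = w / b * (Real.exp (-(b * t)) * Real.exp (-(δ * t)) * (1 + b * t)) := by ring
      _ ≤ w / b * (1 + 2 * (δ * |t|)) := by gcongr
      _ = w / b + w * (2 * δ / b * |t|) := by ring
      _ ≤ w / b + 1 * (2 * δ / b * |t|) := by gcongr
      _ = _ := by rw [one_mul]
  have hsum := Finset.sum_le_sum hterm
  rw [Finset.sum_add_distrib, ← Finset.mul_sum] at hsum
  simp only [Finset.sum_const, nsmul_eq_mul] at hsum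
  set V := 2 * δ / b * ∑ i ∈ S, |p i - u / b| with hV
  have hV0 : 0 ≤ V := mul_nonneg (by positivity) (Finset.sum_nonneg fun i _ => abs_nonneg _)
  have h1 : ∑ i ∈ S, Real.exp (-(b * p i) - δ * (p i - u / b)) * (p i - m * w / b)
      = ∑ i ∈ S, p i * Real.exp (-(b * p i) - δ * (p i - u / b)) - (Z - 1) * (m * w / b) := by
    rw [hZ, add_sub_cancel_left, Finset.sum_mul, ← Finset.sum_sub_distrib]
    exact Finset.sum_congr rfl fun i _ => by ring
  have h2 : (S.card : ℝ) * (w / b) ≤ m * w / b := by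
    rw [mul_div_assoc]
    exact mul_le_mul_of_nonneg_right hS (by positivity)
  rw [div_le_iff₀ (by linarith)]
  nlinarith

/-- In the perturbed model, a price below `u / b` is better than the optimal revenue of the
unperturbed model. -/
lemma improved_revenue (hm : 1 ≤ m) (hb0 : 0 < b) (hb1 : b ≤ 1)
    (hu : u = 1 + m * Real.exp (-u)) (hδ0 : 0 ≤ δ) (hδ1 : δ ≤ 1) :
    m * Real.exp (-u) / b + Real.exp (-u) / (8 * (1 + m)) * δ ^ 2 ≤
      m * ((u / b - δ / 4) * Real.exp (-(b * (u / b - δ / 4)) - δ * (u / b - δ / 4 - u / b))) /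
        (1 + m * Real.exp (-(b * (u / b - δ / 4)) - δ * (u / b - δ / 4 - u / b))) := by
  set w := Real.exp (-u) with hw
  have hw0 : 0 < w := Real.exp_pos _
  have hexp : Real.exp (-(b * (u / b - δ / 4)) - δ * (u / b - δ / 4 - u / b))
      = w * Real.exp ((b + δ) * (δ / 4)) := by
    rw [hw, ← Real.exp_add]
    congr 1
    field_simp
    ring
  set E := Real.exp ((b + δ) * (δ / 4)) with hE
  have hE1 : 1 + (b + δ) * (δ / 4) ≤ E := by
    have := Real.add_one_le_exp ((b + δ) * (δ / 4))
    linarith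
  have hwE : w * E ≤ 1 := by
    rw [hw, hE, ← Real.exp_add, Real.exp_le_one_iff]
    nlinarith
  have hE0 : 0 < E := Real.exp_pos _
  have hprice : u / b - δ / 4 = (1 + m * w - b * δ / 4) / b := by
    field_simp
    linarith
  rw [hexp, le_div_iff₀ (by positivity), hprice]
  -- The terms linear in `δ` cancel because `u / b` is stationary in the base model; the
  -- perturbation contributes `δ ^ 2 / 4`, and at most half of it is lost to `b (b + δ) δ² / 16`.
  have hgain : 1 + δ ^ 2 / 8 ≤ E * (1 - b * δ / 4) := by
    have h1 : 0 ≤ 1 - b * δ / 4 := by nlinarith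
    have h2 : (1 + (b + δ) * (δ / 4)) * (1 - b * δ / 4) ≤ E * (1 - b * δ / 4) := by gcongr
    have h3 : b * (b + δ) ≤ 2 := by nlinarith
    have h4 : (b * (b + δ)) * δ ^ 2 ≤ 2 * δ ^ 2 := by gcongr
    nlinarith
  have hmw : 0 < m * w := by positivity
  have key : m * w / b * (1 + δ ^ 2 / 8) ≤ m * w / b * (E * (1 - b * δ / 4)) := by gcongr
  have hsmall : w / (8 * (1 + m)) * δ ^ 2 * (1 + m * (w * E)) ≤ m * w / b * (δ ^ 2 / 8) := by
    calc w / (8 * (1 + m)) * δ ^ 2 * (1 + m * (w * E))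
        ≤ w / (8 * (1 + m)) * δ ^ 2 * (1 + m * 1) := by gcongr
      _ = 1 * w / 1 * (δ ^ 2 / 8) := by field_simp
      _ ≤ m * w / b * (δ ^ 2 / 8) := by gcongr
  calc (m * w / b + w / (8 * (1 + m)) * δ ^ 2) * (1 + m * (w * E))
      = m * w / b * (1 + m * (w * E)) + w / (8 * (1 + m)) * δ ^ 2 * (1 + m * (w * E)) := by ring
    _ ≤ m * w / b * (1 + m * (w * E)) + m * w / b * (δ ^ 2 / 8) := by gcongr
    _ = m * w / b * (m * (w * E)) + m * w / b * (1 + δ ^ 2 / 8) := by ring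
    _ ≤ m * w / b * (m * (w * E)) + m * w / b * (E * (1 - b * δ / 4)) := by gcongr
    _ = _ := by ring

end Revenue

/-! ### A covariate law with constant first coordinate and scalar second moment. -/

section Covariates

variable {d : ℕ} [NeZero d]

/-- The parameter with coefficients `θ` and `γ` of the first covariate, and no others. -/
noncomputable def axisParam (d : ℕ) [NeZero d] (θ γ : ℝ) : Param d :=
  Sum.elim (Pi.single 0 θ) (Pi.single 0 γ)

lemma baseUtility_axisParam (θ γ : ℝ) (x : Fin d → ℝ) :
    baseUtility (axisParam d θ γ) x = x 0 * θ := by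
  simp [baseUtility, axisParam, Pi.single_apply]

lemma priceSensitivity_axisParam (θ γ : ℝ) (x : Fin d → ℝ) :
    priceSensitivity (axisParam d θ γ) x = x 0 * γ := by
  simp [priceSensitivity, axisParam, Pi.single_apply]

lemma utility_axisParam (θ γ : ℝ) (x : Fin d → ℝ) (p : ℝ) :
    utility (axisParam d θ γ) x p = x 0 * θ - x 0 * γ * p := by
  rw [utility, baseUtility_axisParam, priceSensitivity_axisParam]

lemma norm_axisParam (θ γ : ℝ) :
    ‖WithLp.toLp 2 (axisParam d θ γ)‖ = √(θ ^ 2 + γ ^ 2) := by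
  rw [EuclideanSpace.norm_eq, Fintype.sum_sum_type]
  simp [axisParam, Pi.single_apply, ite_pow]

/-- The law of the `j`-th covariate: constant for `j = 0`, a random sign otherwise. -/
noncomputable def coordLaw (c : ℝ) (j : Fin d) : Measure ℝ :=
  if j = 0 then Measure.dirac c else (2⁻¹ : ℝ≥0∞) • (Measure.dirac c + Measure.dirac (-c))

instance (c : ℝ) (j : Fin d) : IsProbabilityMeasure (coordLaw c j) := by
  unfold coordLaw
  split_ifs
  · infer_instance
  · refine ⟨?_⟩
    simp only [Measure.smul_apply, Measure.add_apply, measure_univ, smul_eq_mul]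
    rw [one_add_one_eq_two]
    exact ENNReal.inv_mul_cancel two_ne_zero ENNReal.ofNat_ne_top

lemma integral_coordLaw (c : ℝ) (j : Fin d) (f : ℝ → ℝ) :
    ∫ x, f x ∂(coordLaw c j) = if j = 0 then f c else (f c + f (-c)) / 2 := by
  unfold coordLaw
  split_ifs
  · exact integral_dirac f c
  · rw [integral_smul_measure, integral_add_measure (integrable_dirac (by simp))
      (integrable_dirac (by simp)), integral_dirac, integral_dirac]
    simp
    ring

/-- A law of the covariates whose first coordinate is constant. -/
noncomputable def signLaw (d : ℕ) [NeZero d] (c : ℝ) : ProbabilityMeasure (Fin d → ℝ) :=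
  ⟨Measure.pi fun j => coordLaw c j, inferInstance⟩

lemma signLaw_coe (c : ℝ) :
    (signLaw d c : Measure (Fin d → ℝ)) = Measure.pi fun j => coordLaw c j := rfl

lemma ae_signLaw_zero (c : ℝ) : ∀ᵐ x ∂(signLaw d c : Measure (Fin d → ℝ)), x 0 = c := by
  rw [signLaw_coe]
  refine (Measure.quasiMeasurePreserving_eval (μ := fun j : Fin d => coordLaw c j) 0).ae
    (p := fun y => y = c) ?_
  rw [coordLaw, if_pos rfl]
  exact (ae_dirac_iff (measurableSet_singleton c)).2 rfl

lemma ae_signLaw_abs {c : ℝ} (hc : 0 ≤ c) :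
    ∀ᵐ x ∂(signLaw d c : Measure (Fin d → ℝ)), ∀ j, |x j| = c := by
  rw [signLaw_coe, ae_all_iff]
  intro j
  refine (Measure.quasiMeasurePreserving_eval (μ := fun j : Fin d => coordLaw c j) j).ae
    (p := fun y => |y| = c) ?_
  have hm : MeasurableSet {y : ℝ | |y| = c} := measurableSet_eq_fun (by fun_prop) (by fun_prop)
  unfold coordLaw
  split_ifs
  · exact (ae_dirac_iff hm).2 (abs_of_nonneg hc)
  · refine Measure.ae_smul_measure ?_ _
    rw [ae_add_measure_iff]
    exact ⟨(ae_dirac_iff hm).2 (abs_of_nonneg hc),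
      (ae_dirac_iff hm).2 ((abs_neg c).trans (abs_of_nonneg hc))⟩

/-- The coordinates are independent with square `c ^ 2`, and all but the first are centred; of two
distinct coordinates at least one is centred. -/
lemma secondMoment_signLaw (c : ℝ) : secondMoment (signLaw d c) = (c ^ 2) • 1 := by
  ext i j
  rw [secondMoment, Matrix.of_apply, signLaw_coe]
  have h1 : ∀ x : Fin d → ℝ, x i * x j
      = ∏ k, ((if k = i then x k else 1) * if k = j then x k else 1) := fun x => by
    rw [Finset.prod_mul_distrib]
    simp
  simp only [h1]
  rw [integral_fintype_prod_eq_prod (μ := fun k : Fin d => coordLaw c k)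
    (f := fun k y => (if k = i then y else 1) * if k = j then y else 1)]
  simp only [integral_coordLaw]
  rcases eq_or_ne i j with rfl | hij
  · rw [Finset.prod_eq_single i]
    · simp only [if_true, Matrix.smul_apply, Matrix.one_apply_eq, smul_eq_mul]
      split_ifs <;> ring
    · intro k _ hk
      simp [hk]
    · simp
  · have hz : (c ^ 2 • (1 : Matrix (Fin d) (Fin d) ℝ)) i j = 0 := by simp [hij]
    rw [hz]
    rcases eq_or_ne i 0 with hi | hi
    · have hj : j ≠ 0 := fun h => hij (hi.trans h.symm)
      refine Finset.prod_eq_zero (Finset.mem_univ j) ?_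
      simp [hj, hij.symm]
    · refine Finset.prod_eq_zero (Finset.mem_univ i) ?_
      simp [hi, hij]

variable {N H : ℕ}

lemma ae_contexts {c : ℝ} :
    ∀ᵐ X ∂(Measure.pi fun _ : Fin (H + 1) => Measure.pi fun _ : Fin N =>
      (signLaw d c : Measure (Fin d → ℝ))), ∀ h i, X h i 0 = c := by
  rw [ae_all_iff]
  intro h
  rw [ae_all_iff]
  intro i
  refine (Measure.quasiMeasurePreserving_eval (μ := fun _ : Fin (H + 1) =>
    Measure.pi fun _ : Fin N => (signLaw d c : Measure (Fin d → ℝ))) h).ae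
    (p := fun Y => Y i 0 = c) ?_
  exact (Measure.quasiMeasurePreserving_eval (μ := fun _ : Fin N =>
    (signLaw d c : Measure (Fin d → ℝ))) i).ae (p := fun x => x 0 = c) (ae_signLaw_zero c)

lemma ae_covariates_abs {c : ℝ} (hc : 0 ≤ c) :
    ∀ᵐ X ∂(Measure.pi fun _ : Fin N => (signLaw d c : Measure (Fin d → ℝ))),
      ∀ i j, |X i j| = c := by
  rw [ae_all_iff]
  intro i
  exact (Measure.quasiMeasurePreserving_eval (μ := fun _ : Fin N =>
    (signLaw d c : Measure (Fin d → ℝ))) i).ae (p := fun x => ∀ j, |x j| = c) (ae_signLaw_abs hc)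

end Covariates

/-! ### Admissibility of the hard instances. -/

section Nondegeneracy

variable {d N K : ℕ} {P : ℝ}

lemma abs_le_norm_param (ν : Param d) (j : Fin d ⊕ Fin d) : |ν j| ≤ ‖WithLp.toLp 2 ν‖ :=
  PiLp.norm_apply_le (p := 2) (WithLp.toLp 2 ν) j

lemma abs_utility_le {ν : Param d} {R : ℝ} (hν : ‖WithLp.toLp 2 ν‖ ≤ R) {x : Fin d → ℝ}
    (hx : ∀ j, |x j| ≤ 1) {p : ℝ} (hp0 : 0 ≤ p) (hp : p ≤ P) :
    |utility ν x p| ≤ d * R * (1 + P) := by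
  have hsum : ∀ f : Fin d → Fin d ⊕ Fin d, |∑ j, x j * ν (f j)| ≤ d * R := fun f => by
    calc |∑ j, x j * ν (f j)| ≤ ∑ j, |x j * ν (f j)| := Finset.abs_sum_le_sum_abs _ _
      _ ≤ ∑ _j : Fin d, R := Finset.sum_le_sum fun j _ => by
          rw [abs_mul]
          have h1 := (abs_le_norm_param ν (f j)).trans hν
          nlinarith [hx j, abs_nonneg (x j), abs_nonneg (ν (f j))]
      _ = d * R := by simp
  have h1 : |baseUtility ν x| ≤ d * R := hsum Sum.inl
  have h2 : |priceSensitivity ν x| ≤ d * R := hsum Sum.inr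
  unfold utility
  calc _ ≤ |baseUtility ν x| + |priceSensitivity ν x * p| := abs_sub _ _
    _ = |baseUtility ν x| + |priceSensitivity ν x| * p := by rw [abs_mul, abs_of_nonneg hp0]
    _ ≤ d * R + d * R * P := by gcongr; exact (abs_nonneg _).trans h2
    _ = _ := by ring

lemma choiceProb_ge {ν : Param d} {X : Covariates d N} {a : Action N K P} {B D : ℝ}
    (hB : ∀ i, |utility ν (X i) (a.2 i)| ≤ B) (hB0 : 0 ≤ B) (hD : (K : ℝ) ≤ D) :
    Real.exp (-B) / (1 + D * Real.exp B) ≤ choiceProb ν X a none ∧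
      ∀ i ∈ a.1.1, Real.exp (-B) / (1 + D * Real.exp B) ≤ choiceProb ν X a (some i) := by
  have h0 := logitDenom_pos ν X a
  have hD0 : 0 ≤ D := (Nat.cast_nonneg K).trans hD
  have hle : logitDenom ν X a ≤ 1 + D * Real.exp B := by
    unfold logitDenom
    have h1 : ∑ l ∈ a.1.1, Real.exp (utility ν (X l) (a.2 l)) ≤ ∑ _l ∈ a.1.1, Real.exp B :=
      Finset.sum_le_sum fun l _ => Real.exp_le_exp.2 ((le_abs_self _).trans (hB l))
    rw [Finset.sum_const, nsmul_eq_mul] at h1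
    have h2 : (a.1.1.card : ℝ) ≤ D := (Nat.cast_le.2 a.1.2).trans hD
    have h3 := mul_le_mul_of_nonneg_right h2 (Real.exp_pos B).le
    linarith
  constructor
  · simp only [choiceProb]
    exact div_le_div₀ zero_le_one (Real.exp_le_one_iff.2 (by linarith)) h0 hle
  · intro i hi
    simp only [choiceProb, if_pos hi]
    exact div_le_div₀ (Real.exp_pos _).le
      (Real.exp_le_exp.2 (neg_le.1 ((neg_le_abs _).trans (hB i)))) h0 hle

end Nondegeneracy

section Admissibility

variable {d N K H : ℕ} [NeZero d] {P : ℝ}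

/-- The constant in the nondegeneracy condition. -/
noncomputable def probFloor (P : ℝ) : ℝ :=
  Real.exp (-(P ^ 2 * 2 * (1 + P))) / (1 + P ^ 2 * Real.exp (P ^ 2 * 2 * (1 + P)))

lemma probFloor_pos (P : ℝ) : 0 < probFloor P := by
  unfold probFloor
  positivity

/-- The markets of the lower bound. -/
noncomputable def axisMarket (c : ℝ) (θ γ : Fin (H + 1) → ℝ) (σ : SourceRule d N K H P) :
    Market d N K H P where
  covLaw := signLaw d c
  ν h := axisParam d (θ h) (γ h)
  source := σ

lemma axisMarket_admissible {c L₀ Cmin Cmax : ℝ} {θ γ : Fin (H + 1) → ℝ}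
    {σ : SourceRule d N K H P} {s₀ : ℕ} (hc0 : 0 ≤ c) (hc1 : c ≤ 1) (hCmin : Cmin ≤ c ^ 2)
    (hCmax : c ^ 2 ≤ Cmax) (hγ : ∀ h, L₀ ≤ c * γ h) (hnorm : ∀ h, θ h ^ 2 + γ h ^ 2 ≤ 1)
    (hP : 0 ≤ P) (hd : (d : ℝ) ≤ P ^ 2) (hK : K ≤ d)
    (hshift : ∃ J : Finset (Fin d ⊕ Fin d), J.card ≤ s₀ ∧
      ∀ h : Fin H, ∀ j, j ∉ J → axisParam d (θ 0) (γ 0) j = axisParam d (θ h.succ) (γ h.succ) j) :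
    (axisMarket c θ γ σ).Admissible s₀ L₀ Cmin Cmax (probFloor P) 1 where
  shift := by
    obtain ⟨J, hJ, h⟩ := hshift
    exact ⟨J, hJ, fun i j hj => sub_eq_zero.2 (h i j hj)⟩
  sensitivity h := by
    filter_upwards [ae_signLaw_zero (d := d) c] with x hx
    change L₀ ≤ priceSensitivity (axisParam d (θ h) (γ h)) x
    rw [priceSensitivity_axisParam, hx]
    exact hγ h
  covariates := by
    filter_upwards [ae_signLaw_abs (d := d) hc0] with x hx j
    rw [hx j]
    exact hc1
  params h := by
    change ‖WithLp.toLp 2 (axisParam d (θ h) (γ h))‖ ≤ 1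
    rw [norm_axisParam]
    exact Real.sqrt_le_one.2 (hnorm h)
  nondegenerate := by
    filter_upwards [ae_covariates_abs (d := d) (N := N) hc0] with X hX a ν' hν'
    -- Radius `1` around a parameter of norm at most `1`; with `d ≤ P ^ 2` this bounds all utilities
    -- by the exponent in `probFloor`.
    have hnu : ‖WithLp.toLp 2 ν'‖ ≤ 2 := by
      have h1 : ‖WithLp.toLp 2 (axisParam d (θ 0) (γ 0))‖ ≤ 1 := by
        rw [norm_axisParam]
        exact Real.sqrt_le_one.2 (hnorm 0)
      have h2 : WithLp.toLp 2 ν' = WithLp.toLp 2 (ν' - axisParam d (θ 0) (γ 0))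
          + WithLp.toLp 2 (axisParam d (θ 0) (γ 0)) := by
        rw [← WithLp.toLp_add, sub_add_cancel]
      rw [h2]
      have h3 : ‖WithLp.toLp 2 (ν' - axisParam d (θ 0) (γ 0))‖ ≤ 1 := hν'
      exact (norm_add_le _ _).trans (by linarith)
    refine choiceProb_ge (fun i => ?_) (by positivity) ((Nat.cast_le.2 hK).trans hd)
    refine (abs_utility_le hnu (fun j => (hX i j).trans_le hc1) (a.2 i).2.1 (a.2 i).2.2).trans ?_
    gcongr
  eigenvalues := by
    intro z hz
    change z ∈ spectrum ℝ (secondMoment (signLaw d c)) at hz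
    rw [secondMoment_signLaw, ← Algebra.algebraMap_eq_smul_one, spectrum.scalar_eq] at hz
    rw [Set.mem_singleton_iff.1 hz]
    exact ⟨hCmin, hCmax⟩

end Admissibility

/-! ### Source rules. -/

section Sources

variable {d N K H : ℕ} {P : ℝ}

/-- The source markets never offer a product. -/
noncomputable def idleSource (d N K H : ℕ) {P : ℝ} (hP : 0 ≤ P) : SourceRule d N K H P where
  act _ := Kernel.const _ (Measure.dirac fun _ =>
    (⟨∅, by simp⟩, fun _ => ⟨0, Set.left_mem_Icc.2 hP⟩))
  markov _ := inferInstance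

lemma idleSource_autonomous (hP : 0 ≤ P) : (idleSource d N K H hP).Autonomous :=
  fun _ _ _ _ _ => rfl

/-- The source markets repeat the decision in the target market. -/
noncomputable def mirrorSource (d N K H : ℕ) (P : ℝ) : SourceRule d N K H P where
  act _ := Kernel.deterministic (fun z _ => z.2.2) (by fun_prop)
  markov _ := inferInstance

lemma mirrorSource_mirroring : (mirrorSource d N K H P).Mirroring :=
  fun _ _ _ _ => Kernel.deterministic_apply (by fun_prop) _

end Sources

/-! ### Per-period regret in terms of the distance to the crossing price. -/

section Gap

variable {d N K H : ℕ} {P : ℝ}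

lemma revenue_eq_div (ν : Param d) (X : Covariates d N) (a : Action N K P) :
    revenue ν X a = (∑ i ∈ a.1.1, (a.2 i : ℝ) * Real.exp (utility ν (X i) (a.2 i))) /
      (1 + ∑ i ∈ a.1.1, Real.exp (utility ν (X i) (a.2 i))) := by
  rw [revenue, Finset.sum_div]
  refine Finset.sum_congr rfl fun i hi => ?_
  simp only [choiceProb, if_pos hi, logitDenom, mul_div_assoc]

/-- Revenues are bounded by `P`, so the real supremum is a genuine upper bound and not the default
value `0`. -/
lemma revenue_le_optRevenue (hP : 0 ≤ P) (ν : Param d) (X : Covariates d N) (a : Action N K P) :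
    revenue ν X a ≤ optRevenue K P ν X := by
  refine le_ciSup (f := fun a : Action N K P => revenue ν X a) ⟨P, ?_⟩ a
  rintro _ ⟨a, rfl⟩
  have hsub : ∑ i ∈ a.1.1, choiceProb ν X a (some i) ≤ 1 := by
    have h1 := sum_choiceProb ν X a
    rw [Fintype.sum_option] at h1
    have h2 := choiceProb_nonneg ν X a none
    have h3 : ∑ i ∈ a.1.1, choiceProb ν X a (some i) ≤ ∑ i, choiceProb ν X a (some i) :=
      Finset.sum_le_univ_sum_of_nonneg fun i => choiceProb_nonneg _ _ _ _
    linarith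
  calc revenue ν X a ≤ ∑ i ∈ a.1.1, P * choiceProb ν X a (some i) :=
        Finset.sum_le_sum fun i _ =>
          mul_le_mul_of_nonneg_right (a.2 i).2.2 (choiceProb_nonneg _ _ _ _)
    _ = P * ∑ i ∈ a.1.1, choiceProb ν X a (some i) := (Finset.mul_sum _ _ _).symm
    _ ≤ P * 1 := mul_le_mul_of_nonneg_left hsub hP
    _ = P := mul_one P

/-- The revenue of `m` products with equal prices and utilities. -/
lemma uniform_revenue_le_optRevenue {m : ℕ} (hmK : m ≤ K) (hmN : m ≤ N) {ν : Param d}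
    {X : Covariates d N} {p v : ℝ} (hp0 : 0 ≤ p) (hp : p ≤ P) (hv : ∀ i, utility ν (X i) p = v) :
    m * (p * Real.exp v) / (1 + m * Real.exp v) ≤ optRevenue K P ν X := by
  obtain ⟨S, -, hS⟩ := Finset.exists_subset_card_eq (s := (Finset.univ : Finset (Fin N))) (n := m)
    (by simpa using hmN)
  refine le_trans (le_of_eq ?_) (revenue_le_optRevenue (hp0.trans hp) ν X
    (⟨S, hS.trans_le hmK⟩, fun _ => ⟨p, hp0, hp⟩))
  rw [revenue_eq_div]
  simp [hv, hS]

/-- The sum of the squared distances of the prices of the offered products to `x`. -/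
noncomputable def sqDist (x : ℝ) (a : Action N K P) : ℝ := ∑ i ∈ a.1.1, ((a.2 i : ℝ) - x) ^ 2

/-- The sum of the distances of the prices of the offered products to `x`. -/
noncomputable def absDist (x : ℝ) (a : Action N K P) : ℝ := ∑ i ∈ a.1.1, |(a.2 i : ℝ) - x|

lemma measurable_sum_assortment {f : Fin N → ℝ → ℝ} (hf : ∀ i, Measurable (f i)) :
    Measurable fun a : Action N K P => ∑ i ∈ a.1.1, f i (a.2 i) := by
  have h : (fun a : Action N K P => ∑ i ∈ a.1.1, f i (a.2 i)) = fun a =>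
      ∑ i, if i ∈ a.1.1 then f i (a.2 i) else 0 := by
    funext a
    simp
  rw [h]
  refine Finset.measurable_fun_sum _ fun i _ => Measurable.ite ?_ ?_ measurable_const
  · exact measurable_fst (MeasurableSet.of_discrete (s := {S : Assortment N K | i ∈ S.1}))
  · exact (hf i).comp (measurable_subtype_coe.comp
      ((measurable_pi_apply i).comp measurable_snd))

lemma measurable_sqDist (x : ℝ) : Measurable (sqDist (N := N) (K := K) (P := P) x) :=
  measurable_sum_assortment (f := fun _ p => (p - x) ^ 2) fun _ => by fun_prop

lemma measurable_absDist (x : ℝ) : Measurable (absDist (N := N) (K := K) (P := P) x) :=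
  measurable_sum_assortment (f := fun _ p => |p - x|) fun _ => by fun_prop

lemma sqDist_nonneg (x : ℝ) (a : Action N K P) : 0 ≤ sqDist x a :=
  Finset.sum_nonneg fun _ _ => sq_nonneg _

lemma abs_price_sub_le {x : ℝ} (hx0 : 0 ≤ x) (hx : x ≤ P) (p : Set.Icc (0 : ℝ) P) :
    |(p : ℝ) - x| ≤ P :=
  abs_le.2 ⟨by linarith [p.2.1], by linarith [p.2.2]⟩

lemma sqDist_le {x : ℝ} (hx0 : 0 ≤ x) (hx : x ≤ P) (a : Action N K P) :
    sqDist x a ≤ K * P ^ 2 := by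
  have h1 : sqDist x a ≤ ∑ _i ∈ a.1.1, P ^ 2 := Finset.sum_le_sum fun i _ => by
    rw [← sq_abs]
    gcongr
    exact abs_price_sub_le hx0 hx _
  rw [Finset.sum_const, nsmul_eq_mul] at h1
  refine h1.trans ?_
  gcongr
  exact a.1.2

variable [NeZero d] {m : ℕ} {b c u δ : ℝ} {X : Covariates d N}

lemma assortment_card_le (hm : m = min K N) (a : Action N K P) : (a.1.1.card : ℝ) ≤ m := by
  rw [hm, Nat.cast_le]
  exact le_min a.1.2 (by simpa using Finset.card_le_univ a.1.1)

/-- The base parameter: utilities `-b p` for covariates with first coordinate `c`. -/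
lemma utility_base (hc : 0 < c) {x : Fin d → ℝ} (hx : x 0 = c) (p : ℝ) :
    utility (axisParam d 0 (b / c)) x p = -(b * p) := by
  rw [utility_axisParam, hx]
  field_simp
  ring

/-- The perturbed parameter, with the same utilities as the base parameter at the price `u / b`. -/
lemma utility_perturbed (hc : 0 < c) {x : Fin d → ℝ} (hx : x 0 = c) (p : ℝ) :
    utility (axisParam d (δ * (u / b) / c) ((b + δ) / c)) x p
      = -(b * p) - δ * (p - u / b) := by
  rw [utility_axisParam, hx]
  generalize u / b = y
  field_simp
  ring

lemma gap_base_ge (hm : m = min K N) (hc : 0 < c) (hX : ∀ i, X i 0 = c) (hb0 : 0 < b) (hb1 : b ≤ 1)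
    (hu1 : 1 ≤ u) (hu : u = 1 + m * Real.exp (-u)) (hP : 1 ≤ P) (huP : u / b ≤ P)
    (a : Action N K P) :
    b * Real.exp (-u) * Real.exp (-P) / (4 * P * (1 + m)) * sqDist (u / b) a ≤
      optRevenue K P (axisParam d 0 (b / c)) X - revenue (axisParam d 0 (b / c)) X a := by
  have h1 := quadratic_revenue_loss (S := a.1.1) (p := fun i => (a.2 i : ℝ))
    (assortment_card_le hm a) hb0 hb1 hu1 hu hP huP fun i _ => ⟨(a.2 i).2.1, (a.2 i).2.2⟩
  have h2 : revenue (axisParam d 0 (b / c)) X a =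
      (∑ i ∈ a.1.1, (a.2 i : ℝ) * Real.exp (-(b * a.2 i))) /
        (1 + ∑ i ∈ a.1.1, Real.exp (-(b * a.2 i))) := by
    rw [revenue_eq_div]
    simp only [utility_base hc (hX _)]
  have h3 := uniform_revenue_le_optRevenue (P := P) (m := m) (by omega : m ≤ K) (by omega : m ≤ N)
    (by positivity) huP fun i => utility_base (b := b) hc (hX i) (u / b)
  -- Offering `m` products at the price `u / b` earns exactly the benchmark, by the equation for
  -- `u`.
  have h4 : m * (u / b * Real.exp (-(b * (u / b)))) / (1 + m * Real.exp (-(b * (u / b))))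
      = m * Real.exp (-u) / b := by
    rw [mul_div_cancel₀ u hb0.ne', ← hu]
    field_simp
  rw [h4] at h3
  rw [h2]
  unfold sqDist
  linarith

/-- The clairvoyant gains order `δ ^ 2` at the price `u / b - δ / 4`, whereas a seller near `u / b`
beats the base optimum by at most order `δ` times the distance. -/
lemma gap_perturbed_ge (hm : m = min K N) (hm1 : 1 ≤ m) (hc : 0 < c) (hX : ∀ i, X i 0 = c)
    (hb0 : 0 < b) (hb1 : b ≤ 1) (hu1 : 1 ≤ u) (hu : u = 1 + m * Real.exp (-u))
    (huP : u / b ≤ P) (hδ0 : 0 ≤ δ) (hδ1 : δ ≤ 1) (hδP : δ * P ≤ 1) (a : Action N K P) :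
    Real.exp (-u) / (8 * (1 + m)) * δ ^ 2 - 2 * δ / b * absDist (u / b) a ≤
      optRevenue K P (axisParam d (δ * (u / b) / c) ((b + δ) / c)) X -
        revenue (axisParam d (δ * (u / b) / c) ((b + δ) / c)) X a := by
  have hub : 1 ≤ u / b := by
    rw [le_div_iff₀ hb0]
    linarith
  have h1 := perturbed_revenue_le (S := a.1.1) (p := fun i => (a.2 i : ℝ))
    (assortment_card_le hm a) hb0 hu1 hu hδ0 fun i _ => le_trans
      (mul_le_mul_of_nonneg_left (abs_price_sub_le (by linarith) huP (a.2 i)) hδ0) hδP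
  have h2 : revenue (axisParam d (δ * (u / b) / c) ((b + δ) / c)) X a =
      (∑ i ∈ a.1.1, (a.2 i : ℝ) * Real.exp (-(b * a.2 i) - δ * (a.2 i - u / b))) /
        (1 + ∑ i ∈ a.1.1, Real.exp (-(b * a.2 i) - δ * (a.2 i - u / b))) := by
    rw [revenue_eq_div]
    simp only [utility_perturbed hc (hX _)]
  have h3 := uniform_revenue_le_optRevenue (P := P) (m := m) (by omega : m ≤ K) (by omega : m ≤ N)
    (by linarith : 0 ≤ u / b - δ / 4) (by linarith)
    fun i => utility_perturbed (b := b) (u := u) (δ := δ) hc (hX i) (u / b - δ / 4)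
  have h4 := improved_revenue (by exact_mod_cast hm1) hb0 hb1 hu hδ0 hδ1
  rw [h2]
  unfold absDist
  linarith

end Gap

/-! ### Information against regret. -/

/-- The trade-off between the regret under the base parameter and under the perturbed one. -/
lemma loss_tradeoff {ι : Type*} (S : Finset ι) (t : ι → ℝ) {D c₁ c₃ e δ : ℝ} (hD : 0 < D)
    (hS : (S.card : ℝ) ≤ D) (hc₁ : 0 < c₁) (hc₃ : 0 < c₃) :
    c₁ * δ ^ 2 / (2 * (1 + e ^ 2 * D / (2 * c₁ * c₃))) ≤
      c₃ * ∑ i ∈ S, t i ^ 2 + max 0 (c₁ * δ ^ 2 - e * δ * ∑ i ∈ S, |t i|) := by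
  set A := e ^ 2 * D / (2 * c₁ * c₃) with hA
  have hA0 : 0 ≤ A := by positivity
  set V := ∑ i ∈ S, t i ^ 2 with hV
  have hV0 : 0 ≤ V := Finset.sum_nonneg fun i _ => sq_nonneg _
  -- Arithmetic–geometric mean, weighted so that the first terms of at most `D` products use up only
  -- half of `c₁ * δ ^ 2`.
  have hterm : ∀ i ∈ S, e * δ * |t i| ≤ c₁ * δ ^ 2 / (2 * D) + e ^ 2 * D / (2 * c₁) * t i ^ 2 := by
    intro i _
    have h1 : c₁ * δ ^ 2 / (2 * D) + e ^ 2 * D / (2 * c₁) * t i ^ 2 - e * δ * |t i|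
        = (c₁ * δ - e * D * |t i|) ^ 2 / (2 * D * c₁) := by
      rw [← sq_abs (t i)]
      field_simp
      ring
    have h2 : 0 ≤ (c₁ * δ - e * D * |t i|) ^ 2 / (2 * D * c₁) := by positivity
    linarith
  have hsum := Finset.sum_le_sum hterm
  rw [← Finset.mul_sum, Finset.sum_add_distrib, ← Finset.mul_sum, Finset.sum_const,
    nsmul_eq_mul] at hsum
  have h1 : (S.card : ℝ) * (c₁ * δ ^ 2 / (2 * D)) ≤ c₁ * δ ^ 2 / 2 := by
    calc _ ≤ D * (c₁ * δ ^ 2 / (2 * D)) := by gcongr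
      _ = _ := by field_simp
  have h2 : e ^ 2 * D / (2 * c₁) * V = A * (c₃ * V) := by
    rw [hA]
    field_simp
  rw [div_le_iff₀ (by positivity)]
  have h3 := le_max_left 0 (c₁ * δ ^ 2 - e * δ * ∑ i ∈ S, |t i|)
  have h4 := le_max_right 0 (c₁ * δ ^ 2 - e * δ * ∑ i ∈ S, |t i|)
  set G := max 0 (c₁ * δ ^ 2 - e * δ * ∑ i ∈ S, |t i|)
  have h5 : 0 ≤ c₃ * V := by positivity
  nlinarith [mul_nonneg hA0 h3]

section Information

variable {d N K H : ℕ} {P : ℝ}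

/-- An upper bound of the information on `ν'` against `ν` that the decisions of one period give,
when all covariates are `X`. -/
noncomputable def information (ν ν' : Fin (H + 1) → Param d) (X : Covariates d N)
    (z : Action N K P × (Fin H → Action N K P)) : ℝ :=
  ∑ h, ∑ i ∈ (decisions z.1 z.2 h).1.1, utilityShift (ν h) (ν' h) X (decisions z.1 z.2 h) i ^ 2

lemma measurable_information (ν ν' : Fin (H + 1) → Param d) (X : Covariates d N) :
    Measurable (information (K := K) (P := P) ν ν' X) := by
  unfold information
  refine Finset.measurable_fun_sum _ fun h _ => ?_
  have h1 : Measurable fun z : Action N K P × (Fin H → Action N K P) => decisions z.1 z.2 h := by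
    refine Fin.cases ?_ (fun i => ?_) h
    · simp only [decisions, Fin.cons_zero]
      exact measurable_fst
    · simp only [decisions, Fin.cons_succ]
      exact (measurable_pi_apply i).comp measurable_snd
  have h2 : Measurable fun a : Action N K P =>
      ∑ i ∈ a.1.1, utilityShift (ν h) (ν' h) X a i ^ 2 :=
    measurable_sum_assortment
      (f := fun i p => (utility (ν' h) (X i) p - utility (ν h) (X i) p) ^ 2)
      fun i => by unfold utility; fun_prop
  exact h2.comp h1

end Information

section TwoMarkets

variable {d N K H : ℕ} [NeZero d] {P : ℝ}

set_option maxHeartbeats 400000 in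
/-- The regret of one of two markets with crossing demand curves, in terms of the information that
the purchases give on the difference of the two. -/
theorem regret_dichotomy {m : ℕ} {b c u δ M c₁ c₃ D : ℝ} {θ γ θ' γ' : Fin (H + 1) → ℝ}
    {σ : SourceRule d N K H P} (hm : m = min K N) (hm1 : 1 ≤ m) (hmD : (m : ℝ) ≤ D) (hc : 0 < c)
    (hb0 : 0 < b) (hb1 : b ≤ 1) (hu1 : 1 ≤ u) (hu : u = 1 + m * Real.exp (-u)) (hP : 1 ≤ P)
    (huP : u / b ≤ P) (hδ0 : 0 < δ) (hδP : δ * P ≤ 1) (hM : 1 ≤ M)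
    (hθ : θ 0 = 0) (hγ : γ 0 = b / c) (hθ' : θ' 0 = δ * (u / b) / c) (hγ' : γ' 0 = (b + δ) / c)
    (hsource : ∀ h : Fin H, (θ h.succ = θ 0 ∧ γ h.succ = γ 0 ∧ θ' h.succ = θ' 0 ∧
      γ' h.succ = γ' 0) ∨ (θ' h.succ = θ h.succ ∧ γ' h.succ = γ h.succ))
    (hinfo : ∀ n (h : History d N K H P n) w, ∀ᵐ a ∂(σ.act n (h, w)),
      information (fun h => axisParam d (θ h) (γ h)) (fun h => axisParam d (θ' h) (γ' h))
        (fun _ _ => c) (w.2, a) ≤ M * δ ^ 2 * sqDist (u / b) w.2)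
    (hc₁ : 0 < c₁) (hc₁' : c₁ ≤ Real.exp (-u) / (8 * (1 + m)))
    (hc₃ : 0 < c₃) (hc₃' : c₃ ≤ b * Real.exp (-u) * Real.exp (-P) / (4 * P * (1 + m)))
    (π : Policy d N K H P) (T : ℕ) :
    ENNReal.ofReal (c₃ / (M * δ ^ 2)) ≤ (axisMarket c θ γ σ).regret π T ∨
      ENNReal.ofReal (T * (c₁ * δ ^ 2 / (2 * (1 + (2 / b) ^ 2 * D / (2 * c₁ * c₃))) *
        (Real.exp (-4) / 2))) ≤
        (axisMarket c θ γ σ).regret π T + (axisMarket c θ' γ' σ).regret π T := by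
  set I₀ := axisMarket c θ γ σ with hI₀
  set I₁ := axisMarket c θ' γ' σ with hI₁
  have hub0 : 0 ≤ u / b := by positivity
  have hδ1 : δ ≤ 1 := by nlinarith
  have hgood : ∀ᵐ X ∂I₀.contextLaw, ∀ h i, X h i 0 = c := ae_contexts
  have hgood₁ : ∀ᵐ X ∂I₁.contextLaw, ∀ h i, X h i 0 = c := ae_contexts
  -- Utilities of axis parameters see only the first coordinate, which is almost surely `c`; this
  -- constant vector stands for all covariates.
  set X₀ : Covariates d N := fun _ _ => c with hX₀
  have hprob : ∀ (θ γ : ℝ) (X : Covariates d N), (∀ i, X i 0 = c) → ∀ (a : Action N K P) y,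
      choiceProb (axisParam d θ γ) X a y = choiceProb (axisParam d θ γ) X₀ a y := by
    intro θ γ X hX a y
    have hut : ∀ i p, utility (axisParam d θ γ) (X i) p = utility (axisParam d θ γ) (X₀ i) p :=
      fun i p => by rw [utility_axisParam, utility_axisParam, hX i]
    cases y <;> simp only [choiceProb, logitDenom, hut]
  have hshift : ∀ h, ∀ a : Action N K P, ∀ i, |utilityShift (I₀.ν h) (I₁.ν h) X₀ a i| ≤ 1 := by
    have h0 : ∀ a : Action N K P, ∀ i, |utilityShift (axisParam d (θ 0) (γ 0))
        (axisParam d (θ' 0) (γ' 0)) X₀ a i| ≤ 1 := fun a i => by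
      rw [hθ, hγ, hθ', hγ', utilityShift, utility_base hc rfl, utility_perturbed hc rfl,
        sub_sub_cancel_left, abs_neg, abs_mul, abs_of_pos hδ0]
      exact (mul_le_mul_of_nonneg_left (abs_price_sub_le hub0 huP _) hδ0.le).trans hδP
    intro h
    refine Fin.cases h0 (fun k a i => ?_) h
    change |utilityShift (axisParam d (θ k.succ) (γ k.succ))
      (axisParam d (θ' k.succ) (γ' k.succ)) X₀ a i| ≤ 1
    rcases hsource k with ⟨h1, h2, h3, h4⟩ | ⟨h1, h2⟩
    · rw [h1, h2, h3, h4]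
      exact h0 a i
    · rw [h1, h2, utilityShift, sub_self]
      simp
  set ℓ : Round d N K H P → ℝ := jointLogLik I₀.ν I₁.ν X₀ with hℓ
  have hℓm : Measurable ℓ := measurable_jointLogLik _ _ _
  have hstep : ∀ n h, I₁.step π n h =
      (I₀.step π n h).withDensity fun ρ => ENNReal.ofReal (Real.exp (ℓ ρ)) := by
    intro n h
    refine Market.step_withDensity (I₀ := I₀) (I₁ := I₁) rfl rfl hℓm ?_ π n h
    filter_upwards [hgood] with X hX a a' y
    exact jointChoiceProb_eq_mul_exp (fun h a y =>
      ⟨hprob _ _ _ (hX h) a y, hprob _ _ _ (hX h) a y⟩) a a' y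
  have hMδ : 0 < M * δ ^ 2 := by positivity
  set v : Round d N K H P → ℝ := fun ρ => M * δ ^ 2 * sqDist (u / b) ρ.1.1.2 with hv
  have hact : Measurable fun ρ : Round d N K H P => ρ.1.1.2 := by fun_prop
  have hvm : Measurable v := ((measurable_sqDist _).comp hact).const_mul _
  have hv0 : ∀ ρ, 0 ≤ v ρ := fun ρ => mul_nonneg hMδ.le (sqDist_nonneg _ _)
  have hvC : ∀ ρ, v ρ ≤ M * δ ^ 2 * (K * P ^ 2) := fun ρ =>
    mul_le_mul_of_nonneg_left (sqDist_le hub0 huP _) hMδ.le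
  have hkl : ∀ n h, ∫ ρ, - ℓ ρ ∂(I₀.step π n h) ≤ ∫ ρ, v ρ ∂(I₀.step π n h) := by
    intro n h
    refine I₀.integral_step_le (f := fun ρ => -ℓ ρ) hℓm.neg (B := (H + 1) * 2) (fun ρ => ?_) hvm
      (fun ρ => (abs_of_nonneg (hv0 ρ)).trans_le (hvC ρ)) π n h ?_
    · rw [abs_neg]
      exact abs_jointLogLik_le _ _ _ hshift ρ
    have hinfo' : ∀ᵐ z ∂(I₀.decisionKernel π n h),
        information I₀.ν I₁.ν X₀ (z.1.2, z.2) ≤ M * δ ^ 2 * sqDist (u / b) z.1.2 :=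
      I₀.ae_decisionKernel_source π n h
        (p := fun z => information I₀.ν I₁.ν X₀ z ≤ M * δ ^ 2 * sqDist (u / b) z.1)
        (measurableSet_le (measurable_information _ _ _)
          (((measurable_sqDist _).comp measurable_fst).const_mul _)) fun w => hinfo n h w
    filter_upwards [hinfo', I₀.ae_decisionKernel π n h hgood] with z hz hX
    refine (sum_jointChoiceProb_mul_neg_jointLogLik_le (fun h a y => hprob _ _ _ (hX h) a y)
      hshift z.1.2 z.2).trans (hz.trans (le_of_eq ?_))
    simp only [hv]
    rw [← Finset.sum_mul, sum_jointChoiceProb, one_mul]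
  have hregret₀ : ∑ n ∈ Finset.range T, ∫⁻ h : History d N K H P n × Round d N K H P,
      ENNReal.ofReal (c₃ * sqDist (u / b) h.2.1.1.2) ∂(I₀.law π n ⊗ₘ I₀.step π n)
        ≤ I₀.regret π T := by
    refine Finset.sum_le_sum fun n _ => ?_
    refine lintegral_mono_ae ?_
    filter_upwards [I₀.ae_law_succ π n hgood] with z hz
    refine ENNReal.ofReal_le_ofReal ?_
    have h1 := gap_base_ge hm hc (hz 0) hb0 hb1 hu1 hu hP huP z.2.1.1.2
    rw [← hγ, ← hθ] at h1
    exact (mul_le_mul_of_nonneg_right hc₃' (sqDist_nonneg _ _)).trans h1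
  have hregret₁ : ∑ n ∈ Finset.range T, ∫⁻ h : History d N K H P n × Round d N K H P,
      ENNReal.ofReal (c₁ * δ ^ 2 - 2 / b * δ * absDist (u / b) h.2.1.1.2)
        ∂(I₁.law π n ⊗ₘ I₁.step π n) ≤ I₁.regret π T := by
    refine Finset.sum_le_sum fun n _ => ?_
    refine lintegral_mono_ae ?_
    filter_upwards [I₁.ae_law_succ π n hgood₁] with z hz
    refine ENNReal.ofReal_le_ofReal ?_
    have h1 := gap_perturbed_ge hm hm1 hc (hz 0) hb0 hb1 hu1 hu huP hδ0.le hδ1 hδP z.2.1.1.2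
    rw [← hγ', ← hθ'] at h1
    refine le_trans ?_ h1
    have h2 := mul_le_mul_of_nonneg_right hc₁' (sq_nonneg δ)
    have h3 : 2 / b * δ = 2 * δ / b := by ring
    rw [h3]
    linarith
  -- Either the information stays within `1` and the hypotheses cannot be told apart, or it was paid
  -- for with base regret.
  rcases le_or_gt (∑ n ∈ Finset.range T, ∫⁻ h : History d N K H P n × Round d N K H P,
      ENNReal.ofReal (v h.2) ∂(I₀.law π n ⊗ₘ I₀.step π n)) 1 with hT | hT
  · right
    refine le_trans ?_ (add_le_add hregret₀ hregret₁)
    rw [← Finset.sum_add_distrib, ENNReal.ofReal_mul (Nat.cast_nonneg T), ENNReal.ofReal_natCast]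
    calc _ = ∑ _n ∈ Finset.range T, ENNReal.ofReal (c₁ * δ ^ 2 /
          (2 * (1 + (2 / b) ^ 2 * D / (2 * c₁ * c₃))) * (Real.exp (-4) / 2)) := by simp
      _ ≤ _ := Finset.sum_le_sum fun n hn => ?_
    have hD0 : 0 < D := lt_of_lt_of_le (by exact_mod_cast hm1) hmD
    refine Market.two_point_period π hℓm (B := (H + 1) * 2) (abs_jointLogLik_le _ _ _ hshift)
      hstep hvm hv0 hvC hkl hT
      (g₀ := fun ρ => c₃ * sqDist (u / b) ρ.1.1.2)
      (g₁ := fun ρ => c₁ * δ ^ 2 - 2 / b * δ * absDist (u / b) ρ.1.1.2)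
      (((measurable_sqDist _).comp hact).const_mul _)
      (measurable_const.sub (((measurable_absDist _).comp hact).const_mul _))
      (by positivity) (fun ρ => ?_) (Finset.mem_range.1 hn)
    have h1 := loss_tradeoff ρ.1.1.2.1.1 (fun i => (ρ.1.1.2.2 i : ℝ) - u / b) (e := 2 / b)
      (δ := δ) hD0 ((assortment_card_le hm _).trans hmD) hc₁ hc₃
    refine (ENNReal.ofReal_le_ofReal h1).trans ?_
    refine ENNReal.ofReal_add_le.trans ?_
    -- The truncation at `0` is already part of `ENNReal.ofReal`.
    rw [ENNReal.ofReal_max, ENNReal.ofReal_zero, max_eq_right zero_le]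
    exact le_rfl
  · left
    refine le_trans ?_ hregret₀
    have h1 : ∀ n, ∫⁻ h : History d N K H P n × Round d N K H P,
        ENNReal.ofReal (c₃ * sqDist (u / b) h.2.1.1.2) ∂(I₀.law π n ⊗ₘ I₀.step π n)
        = ENNReal.ofReal (c₃ / (M * δ ^ 2)) * ∫⁻ h : History d N K H P n × Round d N K H P,
          ENNReal.ofReal (v h.2) ∂(I₀.law π n ⊗ₘ I₀.step π n) := fun n => by
      rw [← lintegral_const_mul' _ _ ENNReal.ofReal_ne_top]
      refine lintegral_congr fun h => ?_
      rw [← ENNReal.ofReal_mul (by positivity)]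
      congr 1
      simp only [hv]
      field_simp
    simp only [h1]
    rw [← Finset.mul_sum]
    calc ENNReal.ofReal (c₃ / (M * δ ^ 2)) = ENNReal.ofReal (c₃ / (M * δ ^ 2)) * 1 :=
          (mul_one _).symm
      _ ≤ _ := mul_le_mul_right hT.le _

end TwoMarkets

/-! ### Choice of the constants. -/

/-- Optimization of the distance `δ` of two hypotheses. -/
lemma max_regret_ge {R₀ R₁ : ℝ≥0∞} {T M δ δ₀ c₃ c₁ E e : ℝ} (hT : 0 < T) (hM : 0 < M)
    (hδ₀ : 0 < δ₀) (hδ₀1 : δ₀ ≤ 1) (hδ : δ ^ 2 = δ₀ ^ 2 / √(T * M)) (hc₃ : 0 < c₃) (hc₁ : 0 < c₁)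
    (hE : 0 < E) (he : 0 < e)
    (h : ENNReal.ofReal (c₃ / (M * δ ^ 2)) ≤ R₀ ∨
      ENNReal.ofReal (T * (c₁ * δ ^ 2 / (2 * E) * (e / 2))) ≤ R₀ + R₁) :
    ENNReal.ofReal (min c₃ (c₁ * δ₀ ^ 2 * e / (8 * E)) * √(T / M)) ≤ max R₀ R₁ := by
  set s := √(T / M) with hs
  have hs0 : 0 < s := Real.sqrt_pos.2 (by positivity)
  have hs2 : T = M * s ^ 2 := by
    rw [hs, Real.sq_sqrt (by positivity)]
    field_simp
  -- Now `M * δ ^ 2 = δ₀ ^ 2 / s` and `T * δ ^ 2 = δ₀ ^ 2 * s`, so both alternatives are multiples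
  -- of `s`.
  have hsq : √(T * M) = M * s := by
    rw [hs2, show M * s ^ 2 * M = (M * s) ^ 2 by ring, Real.sqrt_sq (by positivity)]
  rw [hsq] at hδ
  rcases h with h | h
  · refine le_trans (ENNReal.ofReal_le_ofReal ?_) (h.trans (le_max_left _ _))
    calc _ ≤ c₃ * s := by gcongr; exact min_le_left _ _
      _ ≤ c₃ * s / δ₀ ^ 2 := by
          rw [le_div_iff₀ (by positivity)]
          have : δ₀ ^ 2 ≤ 1 := pow_le_one₀ hδ₀.le hδ₀1
          nlinarith [mul_pos hc₃ hs0]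
      _ = _ := by
          rw [hδ]
          field_simp
  · have h2 : T * (c₁ * δ ^ 2 / (2 * E) * (e / 2)) = 2 * (c₁ * δ₀ ^ 2 * e / (8 * E) * s) := by
      rw [hδ, hs2]
      field_simp
      ring
    rw [h2, ENNReal.ofReal_mul zero_le_two, ENNReal.ofReal_ofNat] at h
    have h3 : R₀ + R₁ ≤ 2 * max R₀ R₁ := by
      rw [two_mul]
      exact add_le_add (le_max_left _ _) (le_max_right _ _)
    have h4 := (ENNReal.mul_le_mul_iff_right two_ne_zero ENNReal.ofNat_ne_top).1 (h.trans h3)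
    refine le_trans (ENNReal.ofReal_le_ofReal ?_) h4
    gcongr
    exact min_le_right _ _

/-- Existence of two hard markets for every rule of the source markets, with a constant that does
not depend on the dimensions. -/
theorem exists_hard_pair {L₀ c P : ℝ} (hL₀ : 0 < L₀) (hL₀c : L₀ < c) (hc1 : c ≤ 1) (hP : 1 ≤ P) :
    ∃ κ, 0 < κ ∧ ∀ d K N H T : ℕ, ∀ _ : NeZero d, 1 ≤ K → K ≤ d → 1 ≤ N → 1 ≤ T →
      (1 + √(d : ℝ) + Real.log K) / L₀ ≤ P → ∀ M : ℝ, 1 ≤ M →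
      ∃ y δ : ℝ, 0 ≤ y ∧ y ≤ P ∧ 0 < δ ∧ δ ≤ (c - L₀) / (2 * (1 + P)) ∧
        ∀ (θ γ θ' γ' : Fin (H + 1) → ℝ) (σ : SourceRule d N K H P),
          θ 0 = 0 → γ 0 = (L₀ + c) / 2 / c → θ' 0 = δ * y / c →
          γ' 0 = ((L₀ + c) / 2 + δ) / c →
          (∀ h : Fin H, (θ h.succ = θ 0 ∧ γ h.succ = γ 0 ∧ θ' h.succ = θ' 0 ∧
            γ' h.succ = γ' 0) ∨ (θ' h.succ = θ h.succ ∧ γ' h.succ = γ h.succ)) →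
          (∀ n (h : History d N K H P n) w, ∀ᵐ a ∂(σ.act n (h, w)),
            information (fun h => axisParam d (θ h) (γ h)) (fun h => axisParam d (θ' h) (γ' h))
              (fun _ _ => c) (w.2, a) ≤ M * δ ^ 2 * sqDist y w.2) →
          ∀ π : Policy d N K H P, ENNReal.ofReal (κ * √(T / M)) ≤
            max ((axisMarket c θ γ σ).regret π T) ((axisMarket c θ' γ' σ).regret π T) := by
  have hc : 0 < c := hL₀.trans hL₀c
  set b := (L₀ + c) / 2 with hb
  have hbL : L₀ ≤ b := by linarith
  have hb0 : 0 < b := by linarith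
  have hb1 : b ≤ 1 := by linarith
  have hP0 : 0 < P := by linarith
  set c₁ := Real.exp (-P) / (8 * (1 + P ^ 2)) with hc₁
  set c₃ := L₀ * Real.exp (-P) * Real.exp (-P) / (4 * P * (1 + P ^ 2)) with hc₃
  have hc₁0 : 0 < c₁ := by positivity
  have hc₃0 : 0 < c₃ := by positivity
  set δ₀ := (c - L₀) / (2 * (1 + P)) with hδ₀
  have hδ₀0 : 0 < δ₀ := div_pos (by linarith) (by positivity)
  have hδ₀P : δ₀ * (1 + P) ≤ 1 := by
    have : δ₀ * (1 + P) = (c - L₀) / 2 := by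
      rw [hδ₀]
      field_simp
    linarith
  have hδ₀1 : δ₀ ≤ 1 := by nlinarith
  set E := 1 + (2 / b) ^ 2 * P ^ 2 / (2 * c₁ * c₃) with hE
  have hE0 : 0 < E := by positivity
  refine ⟨min c₃ (c₁ * δ₀ ^ 2 * Real.exp (-4) / (8 * E)), lt_min hc₃0 (by positivity), ?_⟩
  intro d K N H T _ hK hKd hN hT hlarge M hM
  set m := min K N with hm
  have hm1 : 1 ≤ m := le_min hK hN
  have hm1' : (1 : ℝ) ≤ m := by exact_mod_cast hm1
  have hmK : (m : ℝ) ≤ K := by exact_mod_cast min_le_left K N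
  have hKd' : (K : ℝ) ≤ d := by exact_mod_cast hKd
  have hd1 : (1 : ℝ) ≤ √(d : ℝ) := Real.one_le_sqrt.2 (by linarith)
  rw [div_le_iff₀ hL₀] at hlarge
  have hlogm : Real.log m ≤ Real.log K := Real.log_le_log (by linarith) hmK
  have hlogm0 := Real.log_nonneg hm1'
  have hPL : P * L₀ ≤ P := by nlinarith
  have hdP : (d : ℝ) ≤ P ^ 2 := by
    rw [← Real.sq_sqrt (Nat.cast_nonneg d)]
    have : √(d : ℝ) ≤ P := by linarith
    gcongr
  have hmP : (m : ℝ) ≤ P ^ 2 := by linarith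
  obtain ⟨u, hu1, hu2, hu⟩ := exists_markup hm1'
  have huL : u ≤ P * L₀ := by linarith
  have huP : u / b ≤ P := by
    rw [div_le_iff₀ hb0]
    nlinarith
  have hexp : Real.exp (-P) ≤ Real.exp (-u) := Real.exp_le_exp.2 (by linarith)
  have hT0 : (0 : ℝ) < T := by exact_mod_cast hT
  have hT1 : (1 : ℝ) ≤ T := by exact_mod_cast hT
  have hM0 : 0 < M := by linarith
  have hTM : 1 ≤ √(T * M) := Real.one_le_sqrt.2 (by nlinarith)
  set δ := √(δ₀ ^ 2 / √(T * M)) with hδ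
  have hδ2 : δ ^ 2 = δ₀ ^ 2 / √(T * M) := Real.sq_sqrt (by positivity)
  have hδ0 : 0 < δ := Real.sqrt_pos.2 (by positivity)
  have hδδ₀ : δ ≤ δ₀ := by
    rw [hδ, Real.sqrt_le_left hδ₀0.le]
    exact div_le_self (by positivity) hTM
  have hδP : δ * P ≤ 1 := by nlinarith
  refine ⟨u / b, δ, by positivity, huP, hδ0, hδδ₀, ?_⟩
  intro θ γ θ' γ' σ hθ hγ hθ' hγ' hsource hinfo π
  refine max_regret_ge hT0 hM0 hδ₀0 hδ₀1 hδ2 hc₃0 hc₁0 hE0 (Real.exp_pos _) ?_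
  refine regret_dichotomy hm hm1 hmP hc hb0 hb1 hu1 hu hP huP hδ0 hδP hM hθ hγ hθ' hγ' hsource
    hinfo hc₁0 ?_ hc₃0 ?_ π T
  · rw [hc₁]
    gcongr
  · rw [hc₃]
    gcongr

section Scenarios

variable {d N K H : ℕ} [NeZero d] {P : ℝ} {b c y δ : ℝ}

/-- The two utilities differ by `-δ (p - y)`: the demand curves cross at `y`. -/
lemma sum_utilityShift_sq (hc : 0 < c) (a : Action N K P) :
    ∑ i ∈ a.1.1, utilityShift (axisParam d 0 (b / c)) (axisParam d (δ * y / c) ((b + δ) / c))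
      (fun _ _ => c) a i ^ 2 = δ ^ 2 * sqDist y a := by
  rw [sqDist, Finset.mul_sum]
  refine Finset.sum_congr rfl fun i _ => ?_
  rw [utilityShift, utility_axisParam, utility_axisParam]
  field_simp
  ring

lemma information_eq (hc : 0 < c) (θ γ θ' γ' : Fin H → ℝ) (a : Action N K P)
    (a' : Fin H → Action N K P) :
    information (H := H) (fun h => axisParam d (Fin.cons (α := fun _ => ℝ) 0 θ h)
        (Fin.cons (α := fun _ => ℝ) (b / c) γ h))
      (fun h => axisParam d (Fin.cons (α := fun _ => ℝ) (δ * y / c) θ' h)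
        (Fin.cons (α := fun _ => ℝ) ((b + δ) / c) γ' h)) (fun _ _ => c) (a, a') =
      δ ^ 2 * sqDist y a + ∑ h, ∑ i ∈ (a' h).1.1, utilityShift (axisParam d (θ h) (γ h))
        (axisParam d (θ' h) (γ' h)) (fun _ _ => c) (a' h) i ^ 2 := by
  rw [information, Fin.sum_univ_succ]
  simp only [decisions, Fin.cons_zero, Fin.cons_succ]
  rw [sum_utilityShift_sq hc]

end Scenarios

/-! ### Absorbing the dimensions into powers of the cap. -/

section Rates

variable {P k d s t h : ℝ}

/-- The summands are at most `P ^ 2 * √t` and `P ^ 3 * √t`. -/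
lemma target_rate_le (hP : 1 ≤ P) (hk0 : 0 ≤ k) (hk : k ≤ P ^ 2) (hs0 : 0 ≤ s) (hsd : s ≤ d)
    (hd : d ≤ P ^ 2) (ht : 0 ≤ t) (hh : 0 ≤ h) :
    √(k * (d - s) * t / (1 + h)) + s * √(k * t) ≤ 2 * P ^ 4 * √t := by
  have h1 : √(k * (d - s) * t / (1 + h)) ≤ P ^ 2 * √t := by
    rw [← Real.sqrt_sq (by positivity : 0 ≤ P ^ 2), ← Real.sqrt_mul (by positivity)]
    refine Real.sqrt_le_sqrt ?_
    have h2 : k * (d - s) * t ≤ P ^ 2 * P ^ 2 * t := by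
      gcongr
      all_goals linarith
    have h3 : k * (d - s) * t / (1 + h) ≤ k * (d - s) * t :=
      div_le_self (mul_nonneg (mul_nonneg hk0 (by linarith)) ht) (by linarith)
    nlinarith
  have h2 : √(k * t) ≤ P * √t := by
    rw [← Real.sqrt_sq (by linarith : 0 ≤ P), ← Real.sqrt_mul (by positivity)]
    exact Real.sqrt_le_sqrt (by gcongr)
  have h3 : s * √(k * t) ≤ P ^ 2 * (P * √t) := by
    gcongr
    linarith
  have h4 : P ^ 2 ≤ P ^ 4 := pow_le_pow_right₀ hP (by norm_num)
  have h5 : P ^ 3 ≤ P ^ 4 := pow_le_pow_right₀ hP (by norm_num)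
  have h6 := Real.sqrt_nonneg t
  nlinarith

lemma pooled_rate_le (hP : 1 ≤ P) (hk : k ≤ P ^ 2) (hd0 : 0 ≤ d)
    (hd : d ≤ P ^ 2) (ht : 0 ≤ t) (hh : 0 ≤ h) :
    √(k * d * t / (1 + h)) ≤ 2 * P ^ 4 * √(t / (1 + h)) := by
  have h1 : √(k * d * t / (1 + h)) ≤ P ^ 2 * √(t / (1 + h)) := by
    rw [← Real.sqrt_sq (by positivity : 0 ≤ P ^ 2), ← Real.sqrt_mul (by positivity), mul_div_assoc]
    refine Real.sqrt_le_sqrt ?_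
    have h2 : k * d ≤ P ^ 2 * P ^ 2 := by gcongr
    have h3 : 0 ≤ t / (1 + h) := by positivity
    nlinarith
  have h4 : P ^ 2 ≤ P ^ 4 := pow_le_pow_right₀ hP (by norm_num)
  have h6 := Real.sqrt_nonneg (t / (1 + h))
  nlinarith

end Rates

lemma ae_information_le_of_dirac {d N K H : ℕ} {P r : ℝ} {ν ν' : Fin (H + 1) → Param d}
    {X : Covariates d N} {a : Action N K P} {a' : Fin H → Action N K P}
    {μ : Measure (Fin H → Action N K P)} (hμ : μ = Measure.dirac a')
    (h : information ν ν' X (a, a') ≤ r) : ∀ᵐ z ∂μ, information ν ν' X (a, z) ≤ r := by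
  rw [hμ]
  refine (ae_dirac_iff (measurableSet_le ?_ measurable_const)).2 h
  exact (measurable_information ν ν' X).comp measurable_prodMk_left

lemma le_minimaxRegret {d N K H T : ℕ} {P : ℝ} {C : Set (Market d N K H P)} {r : ℝ≥0∞}
    {I₀ I₁ : Market d N K H P} (h₀ : I₀ ∈ C) (h₁ : I₁ ∈ C)
    (h : ∀ π, r ≤ max (I₀.regret π T) (I₁.regret π T)) : r ≤ minimaxRegret d N K H P T C :=
  le_iInf fun π => (h π).trans (max_le
    (le_iSup₂ (f := fun (I : Market d N K H P) (_ : I ∈ C) => I.regret π T) I₀ h₀)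
    (le_iSup₂ (f := fun (I : Market d N K H P) (_ : I ∈ C) => I.regret π T) I₁ h₁))

end TransferPricing

/-! ### The scenarios for the sources. -/

open TransferPricing in
theorem theorem3 (L₀ Cmin Cmax P : ℝ)
    (hL₀ : 0 < L₀) (hL₀_one : L₀ < 1) (hL₀_Cmax : L₀ ^ 2 < Cmax)
    (hCmin : 0 < Cmin) (hCmin_one : Cmin ≤ 1) (hC : Cmin ≤ Cmax) :
    ∃ c₀ κ r : ℝ, 0 < c₀ ∧ 0 < κ ∧ 0 < r ∧
      ∀ d K s₀ N H T : ℕ, 1 ≤ d → 1 ≤ K → K ≤ d → s₀ ≤ min K d → 1 ≤ N →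
        (1 + √(d : ℝ) + Real.log K) / L₀ ≤ P →
        ENNReal.ofReal (c₀ * (√((K : ℝ) * ((d : ℝ) - s₀) * T / (1 + H)) + s₀ * √((K : ℝ) * T))) ≤
            minimaxRegret d N K H P T
              {I | I.Admissible s₀ L₀ Cmin Cmax κ r ∧ I.source.Autonomous} ∧
        ENNReal.ofReal (c₀ * (√((K : ℝ) * ((d : ℝ) - s₀) * T / (1 + H)) + s₀ * √((K : ℝ) * T))) ≤
            minimaxRegret d N K H P T
              {I | I.Admissible s₀ L₀ Cmin Cmax κ r ∧ I.source.Mirroring} := by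
  have hbound : ∀ d K : ℕ, 1 ≤ d → 1 ≤ K → (1 + √(d : ℝ) + Real.log K) / L₀ ≤ P →
      √(d : ℝ) ≤ P ∧ 1 ≤ P := by
    intro d K hd hK h
    rw [div_le_iff₀ hL₀] at h
    have h1 : 1 ≤ √(d : ℝ) := Real.one_le_sqrt.2 (by exact_mod_cast hd)
    have h2 : 0 ≤ Real.log K := Real.log_nonneg (by exact_mod_cast hK)
    have h3 : 0 < P := by
      by_contra hP
      nlinarith
    have h4 : P * L₀ ≤ P := by nlinarith
    constructor <;> linarith
  -- A cap below `1` contradicts the hypothesis on `P` for all dimensions, so any constants do.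
  rcases lt_or_ge P 1 with hP | hP
  · refine ⟨1, 1, 1, one_pos, one_pos, one_pos, fun d K s₀ N H T hd hK _ _ _ h => ?_⟩
    exact absurd (hbound d K hd hK h).2 (not_le.2 hP)
  -- The largest scale of the covariates compatible with `|x j| ≤ 1` and with the eigenvalue bound
  -- `Cmax`; it exceeds `L₀`.
  set c := √(min 1 Cmax) with hc
  have hmin0 : 0 < min 1 Cmax := lt_min one_pos (hCmin.trans_le hC)
  have hc2 : c ^ 2 = min 1 Cmax := Real.sq_sqrt hmin0.le
  have hc0 : 0 < c := Real.sqrt_pos.2 hmin0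
  have hc1 : c ≤ 1 := Real.sqrt_le_one.2 (min_le_left _ _)
  have hL₀c : L₀ < c := Real.lt_sqrt_of_sq_lt (lt_min (by nlinarith) hL₀_Cmax)
  have hc2min : Cmin ≤ c ^ 2 := hc2 ▸ le_min hCmin_one hC
  have hc2max : c ^ 2 ≤ Cmax := hc2 ▸ min_le_right _ _
  obtain ⟨q, hq, hmain⟩ := exists_hard_pair hL₀ hL₀c hc1 hP
  refine ⟨q / (2 * P ^ 4), probFloor P, 1, by positivity, probFloor_pos P, one_pos, ?_⟩
  intro d K s₀ N H T hd hK hKd hs₀ hN hlarge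
  have hd' : (d : ℝ) ≤ P ^ 2 := by
    rw [← Real.sq_sqrt (Nat.cast_nonneg d)]
    have := (hbound d K hd hK hlarge).1
    gcongr
  have hKd' : (K : ℝ) ≤ d := by exact_mod_cast hKd
  have hs₀d : (s₀ : ℝ) ≤ d := by exact_mod_cast hs₀.trans (min_le_right _ _)
  have hne : NeZero d := ⟨by omega⟩
  have hP0 : 0 ≤ P := by linarith
  rcases Nat.eq_zero_or_pos T with rfl | hT
  · simp
  have hrate : ENNReal.ofReal (q / (2 * P ^ 4) *
      (√((K : ℝ) * ((d : ℝ) - s₀) * T / (1 + H)) + s₀ * √((K : ℝ) * T))) ≤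
      ENNReal.ofReal (q * √(T / 1)) := by
    refine ENNReal.ofReal_le_ofReal ?_
    have h := target_rate_le (h := H) hP (Nat.cast_nonneg K) (hKd'.trans hd') (Nat.cast_nonneg s₀)
      hs₀d hd' (Nat.cast_nonneg T) (Nat.cast_nonneg H)
    calc _ ≤ q / (2 * P ^ 4) * (2 * P ^ 4 * √T) := by gcongr
      _ = _ := by
        rw [div_one]
        field_simp
  -- The midpoint leaves room on both sides: `b > L₀` for the sensitivity and `b / c < 1` for the
  -- norm.
  set b := (L₀ + c) / 2 with hb
  have hγ : c * (b / c) = b := by field_simp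
  have hγ' : ∀ δ, c * ((b + δ) / c) = b + δ := fun δ => by field_simp
  have hnorm : 0 ^ 2 + (b / c) ^ 2 ≤ 1 := by
    have h1 : b / c ≤ 1 := by
      rw [div_le_one hc0]
      linarith
    have h2 : 0 ≤ b / c := by positivity
    nlinarith
  have hnorm' : ∀ y δ, 0 ≤ y → y ≤ P → 0 < δ → δ ≤ (c - L₀) / (2 * (1 + P)) →
      (δ * y / c) ^ 2 + ((b + δ) / c) ^ 2 ≤ 1 := by
    intro y δ hy0 hy hδ0 hδ
    rw [le_div_iff₀ (by positivity)] at hδ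
    -- The Euclidean norm is at most the sum of the coordinates, and `δ * (1 + P) ≤ (c - L₀) / 2 = c
    -- - b`.
    have h1 : δ * y / c + (b + δ) / c ≤ 1 := by
      rw [← add_div, div_le_one hc0]
      nlinarith
    have h2 : 0 ≤ δ * y / c := by positivity
    have h3 : 0 ≤ (b + δ) / c := by positivity
    nlinarith
  have hbL : L₀ ≤ b := by linarith
  have hbase : ∀ σ : SourceRule d N K H P, (axisMarket c (Fin.cons 0 fun _ => 0)
      (Fin.cons (b / c) fun _ => b / c) σ).Admissible s₀ L₀ Cmin Cmax (probFloor P) 1 := by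
    refine fun σ => axisMarket_admissible hc0.le hc1 hc2min hc2max (Fin.cases ?_ fun _ => ?_)
      (Fin.cases ?_ fun _ => ?_) hP0 hd' hKd ⟨∅, by simp, fun _ _ _ => rfl⟩
    · exact hbL.trans hγ.ge
    · exact hbL.trans hγ.ge
    · exact hnorm
    · exact hnorm
  have hpert : ∀ y δ, 0 ≤ y → y ≤ P → 0 < δ → δ ≤ (c - L₀) / (2 * (1 + P)) →
      ∀ σ : SourceRule d N K H P, (axisMarket c (Fin.cons (δ * y / c) fun _ => δ * y / c)
        (Fin.cons ((b + δ) / c) fun _ => (b + δ) / c) σ).Admissible s₀ L₀ Cmin Cmax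
        (probFloor P) 1 := by
    intro y δ hy0 hy hδ0 hδ σ
    refine axisMarket_admissible hc0.le hc1 hc2min hc2max (Fin.cases ?_ fun _ => ?_)
      (Fin.cases ?_ fun _ => ?_) hP0 hd' hKd ⟨∅, by simp, fun _ _ _ => rfl⟩
    · exact (by linarith : L₀ ≤ b + δ).trans (hγ' δ).ge
    · exact (by linarith : L₀ ≤ b + δ).trans (hγ' δ).ge
    · exact hnorm' y δ hy0 hy hδ0 hδ
    · exact hnorm' y δ hy0 hy hδ0 hδ
  constructor
  -- Autonomous sources: idle ones reveal nothing, even though they share the target parameter.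
  · obtain ⟨y, δ, hy0, hy, hδ0, hδ, h⟩ := hmain d K N H T hne hK hKd hN hT hlarge 1 le_rfl
    refine hrate.trans (le_minimaxRegret ⟨hbase _, idleSource_autonomous hP0⟩
      ⟨hpert y δ hy0 hy hδ0 hδ _, idleSource_autonomous hP0⟩ (h
      (Fin.cons 0 fun _ => 0) (Fin.cons (b / c) fun _ => b / c)
      (Fin.cons (δ * y / c) fun _ => δ * y / c) (Fin.cons ((b + δ) / c) fun _ => (b + δ) / c)
      (idleSource d N K H hP0) rfl rfl rfl rfl (fun _ => Or.inl ⟨rfl, rfl, rfl, rfl⟩) ?_))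
    · intro n hist w
      refine ae_information_le_of_dirac rfl ?_
      rw [information_eq hc0]
      simp
  -- Mirroring sources. Without any allowed shift they share the target parameter, and every
  -- decision is answered `1 + H` times.
  rcases Nat.eq_zero_or_pos s₀ with rfl | hs₀pos
  · obtain ⟨y, δ, hy0, hy, hδ0, hδ, h⟩ :=
      hmain d K N H T hne hK hKd hN hT hlarge (1 + H) (by simp)
    have hrate' : ENNReal.ofReal (q / (2 * P ^ 4) * (√((K : ℝ) * ((d : ℝ) - (0 : ℕ)) * T / (1 + H))
        + (0 : ℕ) * √((K : ℝ) * T))) ≤ ENNReal.ofReal (q * √(T / (1 + H))) := by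
      refine ENNReal.ofReal_le_ofReal ?_
      have h := pooled_rate_le (h := H) hP (hKd'.trans hd') (Nat.cast_nonneg d) hd'
        (Nat.cast_nonneg T) (Nat.cast_nonneg H)
      rw [Nat.cast_zero, sub_zero, zero_mul, add_zero]
      calc _ ≤ q / (2 * P ^ 4) * (2 * P ^ 4 * √(T / (1 + H))) := by gcongr
        _ = _ := by field_simp
    refine hrate'.trans (le_minimaxRegret ⟨hbase _, mirrorSource_mirroring⟩
      ⟨hpert y δ hy0 hy hδ0 hδ _, mirrorSource_mirroring⟩ (h
      (Fin.cons 0 fun _ => 0) (Fin.cons (b / c) fun _ => b / c)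
      (Fin.cons (δ * y / c) fun _ => δ * y / c) (Fin.cons ((b + δ) / c) fun _ => (b + δ) / c)
      (mirrorSource d N K H P) rfl rfl rfl rfl (fun _ => Or.inl ⟨rfl, rfl, rfl, rfl⟩) ?_))
    · rintro n hist ⟨X, a⟩
      refine ae_information_le_of_dirac (mirrorSource_mirroring n hist X a) ?_
      rw [information_eq hc0]
      simp only [sum_utilityShift_sq hc0, Finset.sum_const, Finset.card_univ, Fintype.card_fin,
        nsmul_eq_mul]
      exact le_of_eq (by ring)
  · obtain ⟨y, δ, hy0, hy, hδ0, hδ, h⟩ := hmain d K N H T hne hK hKd hN hT hlarge 1 le_rfl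
    -- With a shift allowed, the sources get the base `θ` and the perturbed `γ` under both
    -- hypotheses, so their purchases carry no information.
    have hsource : 0 ^ 2 + ((b + δ) / c) ^ 2 ≤ 1 := by
      have := hnorm' y δ hy0 hy hδ0 hδ
      nlinarith [sq_nonneg (δ * y / c)]
    refine hrate.trans (le_minimaxRegret ⟨?_, mirrorSource_mirroring⟩ ⟨?_, mirrorSource_mirroring⟩ (h
      (Fin.cons 0 fun _ => 0) (Fin.cons (b / c) fun _ => (b + δ) / c)
      (Fin.cons (δ * y / c) fun _ => 0) (Fin.cons ((b + δ) / c) fun _ => (b + δ) / c)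
      (mirrorSource d N K H P) rfl rfl rfl rfl (fun _ => Or.inr ⟨rfl, rfl⟩) ?_))
    · refine axisMarket_admissible hc0.le hc1 hc2min hc2max (Fin.cases ?_ fun _ => ?_)
        -- The shift set depends on the hypothesis: the base target differs from the sources in `γ`
        -- only, the perturbed one in `θ` only.
        (Fin.cases ?_ fun _ => ?_) hP0 hd' hKd ⟨{Sum.inr 0}, (Finset.card_singleton _).trans_le hs₀pos, ?_⟩
      · rintro i (j | j) hj
        · rfl
        · have hj0 : j ≠ 0 := by simpa using hj
          simp [axisParam, hj0]
      · exact hbL.trans hγ.ge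
      · exact (by linarith : L₀ ≤ b + δ).trans (hγ' δ).ge
      · exact hnorm
      · exact hsource
    · refine axisMarket_admissible hc0.le hc1 hc2min hc2max (Fin.cases ?_ fun _ => ?_)
        (Fin.cases ?_ fun _ => ?_) hP0 hd' hKd ⟨{Sum.inl 0}, (Finset.card_singleton _).trans_le hs₀pos, ?_⟩
      · rintro i (j | j) hj
        · have hj0 : j ≠ 0 := by simpa using hj
          simp [axisParam, hj0]
        · rfl
      · exact (by linarith : L₀ ≤ b + δ).trans (hγ' δ).ge
      · exact (by linarith : L₀ ≤ b + δ).trans (hγ' δ).ge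
      · exact hnorm' y δ hy0 hy hδ0 hδ
      · exact hsource
    · intro n hist w
      refine Filter.Eventually.of_forall fun a => ?_
      rw [information_eq hc0]
      simp [utilityShift]
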